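/- Let $f\colon\mathbb{C}\to\widehat{\mathbb{C}}=\mathbb{C}\cup\{\infty\}$ be a transcendental meromorphic function in the Speiser class $\mathcal{S}$, i.e. the set $\operatorname{sing}(f^{-1})\subset\widehat{\mathbb{C}}$ of critical and asymptotic values of $f$ is finite. Here $a\in\widehat{\mathbb{C}}$ is a critical value if $a=f(c)$ for a critical point $c$ of $f$ (a zero of $f'$ or a multiple pole), and an asymptotic value if there is a path $\gamma\colon[0,\infty)\to\mathbb{C}$ with $\gamma(t)\to\infty$ and $f(\gamma(t))\to a$ as $t\to\infty$. Suppose that $f$ has an attracting fixed point $\xi\in\mathbb{C}$ (that is, $f(\xi)=\xi$ and $|f'(\xi)|<1$) whose immediate attracting basin contains all finite singularities of $f^{-1}$, i.e. the set $\operatorname{sing}(f^{-1})\setminus\{\infty\}$; the immediate attracting basin is the connected component containing $\xi$ of the set of all $z\in\mathbb{C}$ for which all iterates $f^k(z)$ are defined and $f^k(z)\to\xi$ as $k\to\infty$. Suppose also that $\infty$ is not an asymptotic value of $f$ and that there exists $M\in\mathbb{N}$ such that every pole of $f$ has multiplicity at most $M$. Let $F(f)$ be the Fatou set, consisting of all $z\in\mathbb{C}$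 that have a neighborhood in which all iterates $f^k$ are defined and form a normal family (with respect to the spherical metric), and let $J(f)=\widehat{\mathbb{C}}\setminus F(f)$ be the Julia set. Then $J(f)$ is totally disconnected and $F(f)$ is connected. -/

import Mathlib

open Filter Topology Set

noncomputable section

namespace MeroDyn

/-- The Riemann sphere `OnePoint ℂ` is compact Hausdorff, so its topology is induced by exactly one
uniform structure, which is the one of the spherical (chordal) metric. -/
instance sphereUniformSpace : UniformSpace (OnePoint ℂ) := uniformSpaceOfCompactR1


/-- `z` is a pole of `f`. -/
def IsPole (f : ℂ → ℂ) (z : ℂ) : Prop := meromorphicOrderAt f z < 0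

open Classical in
/-- The meromorphic function as a map from the plane to the Riemann sphere. -/
def toSphere (f : ℂ → ℂ) (z : ℂ) : OnePoint ℂ :=
  if IsPole f z then OnePoint.infty else (f z : OnePoint ℂ)

/-- `f` is a rational function. -/
def IsRational (f : ℂ → ℂ) : Prop :=
  ∃ P Q : Polynomial ℂ, Q ≠ 0 ∧ ∀ z : ℂ, Q.eval z ≠ 0 → f z = P.eval z / Q.eval z

/-- `f` is a transcendental meromorphic function in the plane. -/
def IsTranscendentalMeromorphic (f : ℂ → ℂ) : Prop :=
  MeromorphicNFOn f Set.univ ∧ ¬ IsRational f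

/-- Critical points of `f : ℂ → ℂ ∪ {∞}`: zeros of the derivative and multiple poles. -/
def IsCriticalPoint (f : ℂ → ℂ) (z : ℂ) : Prop :=
  (¬ IsPole f z ∧ deriv f z = 0) ∨ meromorphicOrderAt f z ≤ ((-2 : ℤ) : WithTop ℤ)

/-- The critical values of `f`, in the Riemann sphere. -/
def criticalValues (f : ℂ → ℂ) : Set (OnePoint ℂ) :=
  toSphere f '' {z | IsCriticalPoint f z}

/-- `a` is an asymptotic value of `f`: `f` tends to `a` along a path in the plane tending to `∞`. -/
def IsAsymptoticValue (f : ℂ → ℂ) (a : OnePoint ℂ) : Prop :=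
  ∃ γ : ℝ → ℂ, ContinuousOn γ (Ici 0) ∧ Tendsto γ atTop (cocompact ℂ) ∧
    Tendsto (fun t => toSphere f (γ t)) atTop (𝓝 a)

/-- The set of singularities of the inverse: critical and asymptotic values. -/
def singInv (f : ℂ → ℂ) : Set (OnePoint ℂ) :=
  criticalValues f ∪ {a | IsAsymptoticValue f a}

/-- The Speiser class. -/
def SpeiserClass : Set (ℂ → ℂ) :=
  {f | IsTranscendentalMeromorphic f ∧ (singInv f).Finite}

/-- All iterates of `f` are defined at `z`: the orbit of `z` never meets a pole (as `∞` is not in the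
domain of `f`). At such a point `f^[k] z` is the true value of the `k`-th iterate for all `k`. -/
def IteratesDefinedAt (f : ℂ → ℂ) (z : ℂ) : Prop := ∀ k : ℕ, ¬ IsPole f (f^[k] z)

/-- A family of sphere-valued maps is normal on `U`: each sequence in it has a subsequence that
converges locally uniformly on `U` with respect to the spherical metric. -/
def IsNormalFamilyOn (𝓕 : Set (ℂ → OnePoint ℂ)) (U : Set ℂ) : Prop :=
  ∀ u : ℕ → ℂ → OnePoint ℂ, (∀ n, u n ∈ 𝓕) →
    ∃ φ : ℕ → ℕ, StrictMono φ ∧ ∃ g : ℂ → OnePoint ℂ,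
      TendstoLocallyUniformlyOn (fun n => u (φ n)) g atTop U

/-- The Fatou set of `f`, a subset of the plane. -/
def fatouSet (f : ℂ → ℂ) : Set ℂ :=
  {z | ∃ U : Set ℂ, IsOpen U ∧ z ∈ U ∧ (∀ w ∈ U, IteratesDefinedAt f w) ∧
    IsNormalFamilyOn (Set.range fun (k : ℕ) (w : ℂ) => ((f^[k] w : ℂ) : OnePoint ℂ)) U}

/-- The Julia set of `f`: the complement of the Fatou set in the Riemann sphere. -/
def juliaSet (f : ℂ → ℂ) : Set (OnePoint ℂ) :=
  ((fun z : ℂ => (z : OnePoint ℂ)) '' fatouSet f)ᶜ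

/-- `ξ` is an attracting (possibly superattracting) fixed point of `f`. -/
def IsAttractingFixedPoint (f : ℂ → ℂ) (ξ : ℂ) : Prop :=
  ¬ IsPole f ξ ∧ f ξ = ξ ∧ ‖deriv f ξ‖ < 1

/-- The basin of `ξ`: the points at which all iterates are defined and converge to `ξ`. -/
def basin (f : ℂ → ℂ) (ξ : ℂ) : Set ℂ :=
  {z | IteratesDefinedAt f z ∧ Tendsto (fun k : ℕ => f^[k] z) atTop (𝓝 ξ)}

/-- The immediate basin of `ξ`: the connected component of the basin that contains `ξ`. -/
def immediateBasin (f : ℂ → ℂ) (ξ : ℂ) : Set ℂ := connectedComponentIn (basin f ξ) ξ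

end MeroDyn

end

namespace MeroDyn

/-- A zero-free holomorphic function on a disc is `exp` of a holomorphic function. -/
theorem exists_log_ball {u : ℂ → ℂ} {c : ℂ} {ρ : ℝ} (hρ : 0 < ρ)
    (hu : DifferentiableOn ℂ u (Metric.ball c ρ)) (h0 : ∀ z ∈ Metric.ball c ρ, u z ≠ 0) :
    ∃ g : ℂ → ℂ, DifferentiableOn ℂ g (Metric.ball c ρ) ∧
      ∀ z ∈ Metric.ball c ρ, Complex.exp (g z) = u z := by
  have hd : DifferentiableOn ℂ (fun z => deriv u z / u z) (Metric.ball c ρ) :=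
    (hu.deriv Metric.isOpen_ball).div hu h0
  obtain ⟨g, hgc, hg⟩ := hd.isExactOn_ball.with_val_at c (Complex.log (u c))
  refine ⟨g, fun z hz => (hg z hz).differentiableAt.differentiableWithinAt, fun z hz => ?_⟩
  have hc : c ∈ Metric.ball c ρ := Metric.mem_ball_self hρ
  have key : ∀ x ∈ Metric.ball c ρ,
      HasDerivAt (fun z => Complex.exp (-g z) * u z) 0 x := fun x hx => by
    have h1 := (hg x hx).neg.cexp
    have h2 := (hu.differentiableAt (Metric.isOpen_ball.mem_nhds hx)).hasDerivAt
    convert! h1.mul h2 using 1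
    have := h0 x hx
    field_simp
    simp
  have hconst : Complex.exp (-g z) * u z = Complex.exp (-g c) * u c :=
    (convex_ball c ρ).is_const_of_fderivWithin_eq_zero (𝕜 := ℂ)
      (f := fun z => Complex.exp (-g z) * u z)
      (fun x hx => (key x hx).differentiableAt.differentiableWithinAt)
      (fun x hx => by
        rw [fderivWithin_of_isOpen Metric.isOpen_ball hx]
        ext; simpa using (key x hx).deriv) hz hc
  rw [hgc, Complex.exp_neg (Complex.log _), Complex.exp_log (h0 c hc), inv_mul_cancel₀ (h0 c hc),
    Complex.exp_neg, inv_mul_eq_one₀ (Complex.exp_ne_zero _)] at hconst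
  exact hconst

/-- Harnack's inequality for `-log ‖u‖`, where `u` is a bounded zero-free holomorphic function. -/
theorem norm_pow_three_le_of_ne_zero {u : ℂ → ℂ} {c : ℂ} {ρ m : ℝ} (hρ : 0 < ρ)
    (hu : DifferentiableOn ℂ u (Metric.ball c ρ)) (h0 : ∀ z ∈ Metric.ball c ρ, u z ≠ 0)
    (hm : ∀ z ∈ Metric.ball c ρ, ‖u z‖ < m) {z : ℂ} (hz : dist z c ≤ ρ / 2) :
    ‖u z‖ ^ 3 ≤ m ^ 2 * ‖u c‖ := by
  obtain ⟨g, hg, hgu⟩ := exists_log_ball hρ hu h0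
  have hc : c ∈ Metric.ball c ρ := Metric.mem_ball_self hρ
  have hz' : z ∈ Metric.ball c ρ := by rw [Metric.mem_ball]; linarith
  have hm0 : 0 < m := (norm_nonneg _).trans_lt (hm c hc)
  have hnorm : ∀ x ∈ Metric.ball c ρ, ‖u x‖ = Real.exp (g x).re := fun x hx => by
    rw [← hgu x hx, Complex.norm_exp]
  have hre : ∀ x ∈ Metric.ball c ρ, (g x).re < Real.log m := fun x hx => by
    rw [Real.lt_log_iff_exp_lt hm0, ← hnorm x hx]; exact hm x hx
  set l := Real.log m
  set v : ℂ → ℂ := fun x => l - g x with hv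
  have hvre : ∀ x ∈ Metric.ball c ρ, 0 < (v x).re := fun x hx => by
    simpa [hv] using hre x hx
  have hne : ∀ x ∈ Metric.ball c ρ, v x + (starRingEnd ℂ) (v c) ≠ 0 := fun x hx h => by
    have := congrArg Complex.re h
    have h1 := hvre x hx
    have h2 := hvre c hc
    simp at this
    linarith
  have hvd : DifferentiableOn ℂ v (Metric.ball c ρ) := hg.const_sub _
  have hφ := Complex.dist_le_div_mul_dist_of_mapsTo_ball (R₂ := 1)
    (f := fun x => (v x - v c) / (v x + (starRingEnd ℂ) (v c)))
    ((hvd.sub_const _).div (hvd.add_const _) hne) (fun x hx => by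
      have h1 := hvre x hx
      have h2 := hvre c hc
      simp only [sub_self, zero_div, Metric.mem_closedBall, dist_zero_right, norm_div]
      rw [div_le_one (norm_pos_iff.2 (hne x hx))]
      refine (sq_le_sq₀ (norm_nonneg _) (norm_nonneg _)).1 ?_
      rw [Complex.sq_norm, Complex.sq_norm, Complex.normSq_apply, Complex.normSq_apply]
      simp
      nlinarith) hz'
  simp only [sub_self, zero_div, dist_zero_right, norm_div] at hφ
  have h1 := hvre z hz'
  have h2 := hvre c hc
  have hφ' : ‖v z - v c‖ ≤ 1 / 2 * ‖v z + (starRingEnd ℂ) (v c)‖ := by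
    rw [← div_le_iff₀ (norm_pos_iff.2 (hne z hz'))]
    refine hφ.trans ?_
    rw [div_mul_eq_mul_div, one_mul, div_le_iff₀ hρ]
    linarith
  have hsq := (sq_le_sq₀ (norm_nonneg _) (by positivity)).2 hφ'
  rw [mul_pow, Complex.sq_norm, Complex.sq_norm, Complex.normSq_apply, Complex.normSq_apply] at hsq
  simp only [Complex.sub_re, Complex.sub_im, Complex.add_re, Complex.add_im, Complex.conj_re,
    Complex.conj_im] at hsq
  have h3 : (v c).re ≤ 3 * (v z).re := by
    by_contra hcon
    push Not at hcon
    nlinarith [sq_nonneg ((v z).im - (v c).im), mul_pos h1 h2,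
      mul_pos (sub_pos.2 hcon) (show 0 < 3 * (v c).re - (v z).re by linarith)]
  rw [hnorm z hz', hnorm c hc, ← Real.exp_log hm0, ← Real.exp_nat_mul, ← Real.exp_nat_mul,
    ← Real.exp_add, Real.exp_le_exp]
  simp only [hv, Complex.sub_re, Complex.ofReal_re] at h3
  push_cast
  linarith

/-- A bounded holomorphic function with derivative bounded below at the centre of a disc covers a
disc of definite size. -/
theorem exists_ball_subset_image {ρ m c : ℝ} (hρ : 0 < ρ) (hm : 0 < m) (hc : 0 < c) :
    ∃ s > 0, ∀ (k : ℂ → ℂ) (w : ℂ), DifferentiableOn ℂ k (Metric.ball w ρ) →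
      (∀ z ∈ Metric.ball w ρ, ‖k z‖ ≤ m) → c ≤ ‖deriv k w‖ →
      Metric.ball (k w) s ⊆ k '' Metric.ball w ρ := by
  set B := 4 * m / ρ with hB
  have hB0 : 0 < B := by positivity
  set t := min (c * ρ / (2 * B)) (ρ / 2) with ht
  have ht0 : 0 < t := by positivity
  have htρ : t < ρ := (min_le_right _ _).trans_lt (by linarith)
  refine ⟨t * (c / 2) / 2, by positivity, fun k w hk hkm hkc => ?_⟩
  have hw : w ∈ Metric.ball w ρ := Metric.mem_ball_self hρ
  have hmaps : MapsTo k (Metric.ball w ρ) (Metric.closedBall (k w) (2 * m)) := fun x hx => by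
    rw [Metric.mem_closedBall, dist_eq_norm]
    have := norm_sub_le (k x) (k w)
    linarith [hkm x hx, hkm w hw]
  have hbd : ∀ x ∈ Metric.ball w ρ, ‖dslope k w x‖ ≤ 2 * m / ρ := fun x hx =>
    Complex.norm_dslope_le_div_of_mapsTo_ball hk hmaps hx
  have hds : DifferentiableOn ℂ (dslope k w) (Metric.ball w ρ) :=
    (Complex.differentiableOn_dslope (Metric.isOpen_ball.mem_nhds hw)).2 hk
  have hmaps2 : MapsTo (dslope k w) (Metric.ball w ρ) (Metric.closedBall (dslope k w w) B) :=
    fun x hx => by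
      rw [Metric.mem_closedBall, dist_eq_norm]
      have := norm_sub_le (dslope k w x) (dslope k w w)
      have h4 : B = 2 * m / ρ + 2 * m / ρ := by rw [hB]; ring
      linarith [hbd x hx, hbd w hw]
  have hlow : ∀ z ∈ Metric.sphere w t, t * (c / 2) ≤ ‖k z - k w‖ := fun z hz => by
    have hz' : dist z w = t := hz
    have hzb : z ∈ Metric.ball w ρ := by rw [Metric.mem_ball, hz']; exact htρ
    have h1 := Complex.dist_le_div_mul_dist_of_mapsTo_ball hds hmaps2 hzb
    rw [hz', dslope_same, dist_eq_norm] at h1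
    have h2 : B / ρ * t ≤ c / 2 := by
      have : t ≤ c * ρ / (2 * B) := min_le_left _ _
      calc B / ρ * t ≤ B / ρ * (c * ρ / (2 * B)) := by gcongr
        _ = c / 2 := by field_simp
    have h3 : c / 2 ≤ ‖dslope k w z‖ := by
      have := norm_sub_norm_le (deriv k w) (dslope k w z)
      rw [norm_sub_rev] at this
      linarith
    have h4 := sub_smul_dslope k w z
    rw [← h4, norm_smul, ← dist_eq_norm, hz']
    gcongr
  have hcl : Metric.closedBall w t ⊆ Metric.ball w ρ := Metric.closedBall_subset_ball htρ
  have hdc : DiffContOnCl ℂ k (Metric.ball w t) := by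
    refine (hk.mono ?_).diffContOnCl
    rw [closure_ball w ht0.ne']; exact hcl
  refine (hdc.ball_subset_image_closedBall ht0 hlow ?_).trans (image_mono hcl)
  intro h
  have h5 : deriv k w = 0 := by
    have : k =ᶠ[𝓝 w] fun _ => k w := by filter_upwards [h] with x hx using not_not.1 hx
    rw [this.deriv_eq, deriv_const]
  rw [h5, norm_zero] at hkc
  linarith

/-- A zero-free continuous function on a totally disconnected compact space has a logarithm. -/
theorem exists_log_of_totallyDisconnected {X : Type*} [TopologicalSpace X] [CompactSpace X]
    [T2Space X] [TotallyDisconnectedSpace X] (q : C(X, ℂ)) (hq : ∀ x, q x ≠ 0) :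
    ∃ L : C(X, ℂ), ∀ x, Complex.exp (L x) = q x := by
  classical
  suffices h : ∃ V : Set X, IsClopen V ∧ univ ⊆ V ∧ ∃ L : X → ℂ, ContinuousOn L V ∧
      ∀ x ∈ V, Complex.exp (L x) = q x by
    obtain ⟨V, -, hV, L, hL, hexp⟩ := h
    obtain rfl : V = univ := univ_subset_iff.1 hV
    exact ⟨⟨L, continuousOn_univ.1 hL⟩, fun x => hexp x (mem_univ x)⟩
  refine isCompact_univ.induction_on
    (p := fun s => ∃ V : Set X, IsClopen V ∧ s ⊆ V ∧ ∃ L : X → ℂ, ContinuousOn L V ∧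
      ∀ x ∈ V, Complex.exp (L x) = q x) ?_ ?_ ?_ ?_
  · exact ⟨∅, isClopen_empty, Subset.rfl, fun _ => 0, by simp, by simp⟩
  · rintro s t hst ⟨V, hV, htV, L⟩
    exact ⟨V, hV, hst.trans htV, L⟩
  · rintro s t ⟨V, hV, hsV, L, hL, hLe⟩ ⟨W, hW, htW, L', hL', hLe'⟩
    refine ⟨V ∪ W, hV.union hW, union_subset_union hsV htW, V.piecewise L L', ?_, ?_⟩
    · rw [← union_sdiff_self]
      refine ContinuousOn.union_of_isOpen (hL.congr (piecewise_eqOn V L L'))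
        ((hL'.mono sdiff_subset).congr fun x hx => piecewise_eq_of_notMem V L L' hx.2)
        hV.isOpen (hW.diff hV).isOpen
    · intro x hx
      by_cases hxV : x ∈ V
      · rw [piecewise_eq_of_mem V L L' hxV]; exact hLe x hxV
      · rw [piecewise_eq_of_notMem V L L' hxV]; exact hLe' x (hx.resolve_left hxV)
  · intro x _
    have hopen : IsOpen {y | q y / q x ∈ Complex.slitPlane} :=
      Complex.isOpen_slitPlane.preimage (q.continuous.div_const _)
    obtain ⟨V, hV, hxV, hVs⟩ := compact_exists_isClopen_in_isOpen (x := x) hopen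
      (by
          change q x / q x ∈ Complex.slitPlane
          rw [div_self (hq x)]
          exact Complex.one_mem_slitPlane)
    refine ⟨V, mem_nhdsWithin_of_mem_nhds (hV.isOpen.mem_nhds hxV), V, hV, Subset.rfl,
      fun y => Complex.log (q y / q x) + Complex.log (q x), ?_, ?_⟩
    · exact (ContinuousOn.clog (q.continuous.div_const _).continuousOn fun y hy => hVs hy).add
        continuousOn_const
    · intro y _
      rw [Complex.exp_add, Complex.exp_log (div_ne_zero (hq y) (hq x)), Complex.exp_log (hq x),
        div_mul_cancel₀ _ (hq x)]

/-- A continuous function on the plane that equals `t - b` near infinity has a zero. -/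
theorem exists_eq_zero_of_eq_sub_const {u : ℂ → ℂ} (hu : Continuous u) {b : ℂ} {R : ℝ}
    (h : ∀ t, R < ‖t‖ → u t = t - b) : ∃ t, u t = 0 := by
  by_contra! hne
  obtain ⟨ℓ, ⟨-, hℓ⟩, -⟩ := Complex.isCoveringMapOn_exp.existsUnique_continuousMap_lifts
    (⟨u, hu⟩ : C(ℂ, ℂ)) (a₀ := 0) (e₀ := Complex.log (u 0)) (Complex.exp_log (hne 0))
    (fun a => hne a)
  have hℓ' : ∀ t, Complex.exp (ℓ t) = u t := fun t => congrFun hℓ t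
  set R' := |R| + ‖b‖ + 1 with hR'
  have hR'0 : 0 < R' := by positivity
  set ψ : ℝ → ℂ := fun θ => ℓ (b + R' * Complex.exp (θ * Complex.I)) - θ * Complex.I with hψ
  have hψc : Continuous ψ := by fun_prop
  have hbig : ∀ θ : ℝ, R < ‖b + R' * Complex.exp (θ * Complex.I)‖ := fun θ => by
    have h1 := norm_sub_norm_le (R' * Complex.exp (θ * Complex.I)) (-b)
    rw [norm_mul, Complex.norm_exp_ofReal_mul_I, mul_one, Complex.norm_real, Real.norm_eq_abs,
      abs_of_pos hR'0, norm_neg, sub_neg_eq_add, add_comm] at h1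
    have := le_abs_self R
    rw [add_comm] at h1
    rw [add_comm b]
    linarith
  have hexp : ∀ θ, Complex.exp (ψ θ) = R' := fun θ => by
    rw [hψ]
    simp only
    rw [Complex.exp_sub, hℓ', h _ (hbig θ), add_sub_cancel_left,
      mul_div_cancel_right₀ _ (Complex.exp_ne_zero _)]
  have hend : ψ (2 * Real.pi) = ψ 0 - 2 * Real.pi * Complex.I := by
    simp only [hψ]
    push_cast
    rw [Complex.exp_two_pi_mul_I]
    simp
  have him : Continuous fun θ => (ψ θ).im := Complex.continuous_im.comp hψc
  have hpi := Real.pi_pos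
  obtain ⟨θ, -, hθ⟩ := intermediate_value_Icc' (by linarith : (0 : ℝ) ≤ 2 * Real.pi)
    him.continuousOn (show (ψ 0).im - Real.pi ∈ Icc (ψ (2 * Real.pi)).im (ψ 0).im by
      rw [hend]
      constructor <;> simp <;> linarith)
  have h1 : Complex.exp (ψ θ - ψ 0) = 1 := by
    rw [Complex.exp_sub, hexp, hexp, div_self (by exact_mod_cast hR'0.ne')]
  obtain ⟨n, hn⟩ := Complex.exp_eq_one_iff.1 h1
  have h2 := congrArg Complex.im hn
  simp [hθ] at h2
  have h3 : (2 * n + 1 : ℝ) * Real.pi = 0 := by linarith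
  rcases mul_eq_zero.1 h3 with h4 | h4
  · have : (2 * n + 1 : ℤ) = 0 := by exact_mod_cast h4
    omega
  · exact hpi.ne' h4

theorem isPreconnected_norm_gt (R : ℝ) : IsPreconnected {t : ℂ | R < ‖t‖} := by
  rcases lt_or_ge R 0 with hR | hR
  · have : {t : ℂ | R < ‖t‖} = univ := by
      ext t; simpa using hR.trans_le (norm_nonneg t)
    rw [this]; exact isPreconnected_univ
  rcases hR.eq_or_lt with rfl | hR
  · have : {t : ℂ | 0 < ‖t‖} = Complex.exp '' univ := by
      ext t; simp
    rw [this]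
    exact isPreconnected_univ.image _ Complex.continuous_exp.continuousOn
  · have : {t : ℂ | R < ‖t‖} = Complex.exp '' {z | Real.log R < z.re} := by
      ext t
      constructor
      · intro ht
        have ht0 : t ≠ 0 := norm_pos_iff.1 (hR.trans ht)
        refine ⟨Complex.log t, ?_, Complex.exp_log ht0⟩
        change _ < (Complex.log t).re
        rw [Complex.log_re]
        exact Real.log_lt_log hR ht
      · rintro ⟨z, hz, rfl⟩
        change _ < ‖_‖
        rw [Complex.norm_exp]
        exact (Real.log_lt_iff_lt_exp hR).1 hz
    rw [this]
    exact (convex_halfSpace_re_gt _).isPreconnected.image _ Complex.continuous_exp.continuousOn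

/-- A totally disconnected compact set does not separate the plane. -/
theorem isPreconnected_compl_of_isTotallyDisconnected {K : Set ℂ} (hK : IsCompact K)
    (htd : IsTotallyDisconnected K) : IsPreconnected Kᶜ := by
  classical
  obtain ⟨R, hR⟩ := hK.isBounded.exists_norm_le
  have hext : {t : ℂ | R < ‖t‖} ⊆ Kᶜ := fun t ht htK => (hR t htK).not_gt ht
  have key : ∀ u v : Set ℂ, IsOpen u → IsOpen v → Kᶜ ⊆ u ∪ v → Kᶜ ∩ (u ∩ v) = ∅ →
      {t : ℂ | R < ‖t‖} ⊆ u → Kᶜ ∩ v = ∅ := by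
    intro u v hu hv huv hdisj hRu
    by_contra hne
    obtain ⟨b, hbK, hbv⟩ := nonempty_iff_ne_empty.2 hne
    set A := Kᶜ ∩ v with hA
    have hAo : IsOpen A := hK.isClosed.isOpen_compl.inter hv
    have : CompactSpace K := isCompact_iff_compactSpace.1 hK
    have : TotallyDisconnectedSpace K := totallyDisconnectedSpace_subtype_iff.2 htd
    obtain ⟨L, hL⟩ := exists_log_of_totallyDisconnected
      (⟨fun x : K => (x : ℂ) - b, by fun_prop⟩ : C(K, ℂ))
      (fun x hx => hbK (by
        have : (x : ℂ) = b := sub_eq_zero.1 hx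
        rw [← this]; exact x.2))
    obtain ⟨g, hg⟩ := L.exists_restrict_eq hK.isClosed
    have hfr : frontier A ⊆ K := by
      intro t ht
      by_contra htK
      rcases huv htK with h1 | h1
      · have hB : IsOpen (Kᶜ ∩ u) := hK.isClosed.isOpen_compl.inter hu
        obtain ⟨y, hy1, hy2⟩ := mem_closure_iff.1 (frontier_subset_closure ht) _ hB ⟨htK, h1⟩
        have : y ∈ Kᶜ ∩ (u ∩ v) := ⟨hy1.1, hy1.2, hy2.2⟩
        rw [hdisj] at this
        exact this
      · rw [hAo.frontier_eq] at ht
        exact ht.2 ⟨htK, h1⟩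
    have hcont : Continuous (A.piecewise (fun t => Complex.exp (g t)) fun t => t - b) := by
      refine continuous_piecewise (fun t ht => ?_) (by fun_prop) (by fun_prop)
      have htK := hfr ht
      have := hL ⟨t, htK⟩
      rw [← hg] at this
      exact this
    obtain ⟨t, ht⟩ := exists_eq_zero_of_eq_sub_const hcont (b := b) (R := R) (fun t ht => by
      refine piecewise_eq_of_notMem _ _ _ fun htA => ?_
      have : t ∈ Kᶜ ∩ (u ∩ v) := ⟨hext ht, hRu ht, htA.2⟩
      rw [hdisj] at this
      exact this)
    by_cases htA : t ∈ A
    · rw [piecewise_eq_of_mem _ _ _ htA] at ht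
      exact Complex.exp_ne_zero _ ht
    · rw [piecewise_eq_of_notMem _ _ _ htA] at ht
      exact htA (by rw [sub_eq_zero.1 ht]; exact ⟨hbK, hbv⟩)
  intro u v hu hv huv ⟨x, hx⟩ ⟨y, hy⟩
  by_contra hcon
  have hdisj : Kᶜ ∩ (u ∩ v) = ∅ := not_nonempty_iff_eq_empty.1 hcon
  rcases isPreconnected_iff_subset_of_disjoint.1 (isPreconnected_norm_gt R) u v hu hv
    (hext.trans huv) (by
      refine eq_empty_of_subset_empty ?_
      rw [← hdisj]; exact inter_subset_inter_left _ hext) with h1 | h1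
  · have := key u v hu hv huv hdisj h1
    rw [this] at hy; exact hy
  · have := key v u hv hu (by rwa [union_comm]) (by rwa [inter_comm v u]) h1
    rw [this] at hx; exact hx

/-- A homeomorphism of the plane supported in a disc that moves its centre to a given point. -/
theorem exists_homeomorph_move {p q : ℂ} {δ : ℝ} (hpq : dist q p < δ) :
    ∃ φ : ℂ ≃ₜ ℂ, φ p = q ∧ ∀ z, δ ≤ dist z p → φ z = z := by
  have hδ : 0 < δ := dist_nonneg.trans_lt hpq
  set v := q - p with hv
  set φ : ℂ → ℂ := fun z => z + (max 0 (1 - dist z p / δ) : ℝ) • v with hφ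
  have hlip : ∀ x y : ℂ, |max 0 (1 - dist x p / δ) - max 0 (1 - dist y p / δ)| ≤ dist x y / δ :=
    fun x y => by
      refine (abs_max_sub_max_le_max _ _ _ _).trans ?_
      rw [sub_self, abs_zero, max_eq_right (abs_nonneg _), sub_sub_sub_cancel_left, ← sub_div,
        abs_div, abs_of_pos hδ, abs_sub_comm]
      gcongr
      exact abs_dist_sub_le x y p
  set c : NNReal := ⟨dist q p / δ, by positivity⟩ with hc
  have happ : ApproximatesLinearOn φ
      ((ContinuousLinearEquiv.refl ℝ ℂ : ℂ ≃L[ℝ] ℂ) : ℂ →L[ℝ] ℂ) univ c := by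
    intro x _ y _
    have : φ x - φ y - ((ContinuousLinearEquiv.refl ℝ ℂ : ℂ ≃L[ℝ] ℂ) : ℂ →L[ℝ] ℂ) (x - y) =
        (max 0 (1 - dist x p / δ) - max 0 (1 - dist y p / δ)) • v := by
      simp only [hφ, sub_smul, ContinuousLinearEquiv.coe_coe, ContinuousLinearEquiv.refl_apply]
      ring
    rw [this, norm_smul, Real.norm_eq_abs]
    calc _ ≤ dist x y / δ * ‖v‖ := by gcongr; exact hlip x y
      _ = c * ‖x - y‖ := by
        rw [hc, hv, ← dist_eq_norm, ← dist_eq_norm]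
        change _ = dist q p / δ * dist x y
        ring
  have hc1 : c < ‖((ContinuousLinearEquiv.refl ℝ ℂ).symm : ℂ →L[ℝ] ℂ)‖₊⁻¹ := by
    have h1 : ‖((ContinuousLinearEquiv.refl ℝ ℂ).symm : ℂ →L[ℝ] ℂ)‖₊ = 1 := by
      rw [← NNReal.coe_inj]
      exact ContinuousLinearMap.norm_id
    rw [h1, inv_one, ← NNReal.coe_lt_coe]
    change dist q p / δ < 1
    rwa [div_lt_one hδ]
  refine ⟨happ.toHomeomorph φ (Or.inr hc1), ?_, fun z hz => ?_⟩
  · change φ p = q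
    simp [hφ, hv]
  · change φ z = z
    have : max 0 (1 - dist z p / δ) = 0 := by
      rw [max_eq_left_iff, sub_nonpos, one_le_div hδ]; exact hz
    simp [hφ, this]

/-- Any point of a domain can be moved into a disc by a homeomorphism supported in a compact subset
of the domain and fixing a smaller disc. -/
theorem exists_homeomorph_mem_ball {U : Set ℂ} (hU : IsOpen U) (hUc : IsPreconnected U) {ξ : ℂ}
    {ρ₁ ρ₂ : ℝ} (hρ : ρ₁ < ρ₂) (hρ₂ : 0 < ρ₂) (hball : Metric.ball ξ ρ₂ ⊆ U) {s : ℂ} (hs : s ∈ U) :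
    ∃ (φ : ℂ ≃ₜ ℂ) (K : Set ℂ), IsCompact K ∧ K ⊆ U ∧ (∀ z ∉ K, φ z = z) ∧
      (∀ z ∈ Metric.closedBall ξ ρ₁, φ z = z) ∧ φ s ∈ Metric.ball ξ ρ₂ := by
  set R : Set ℂ := {p | ∃ (φ : ℂ ≃ₜ ℂ) (K : Set ℂ), IsCompact K ∧ K ⊆ U ∧ (∀ z ∉ K, φ z = z) ∧
      (∀ z ∈ Metric.closedBall ξ ρ₁, φ z = z) ∧ φ p ∈ Metric.ball ξ ρ₂} with hR
  have hbR : Metric.ball ξ ρ₂ ⊆ R := fun p hp =>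
    ⟨Homeomorph.refl ℂ, ∅, isCompact_empty, empty_subset _, fun _ _ => rfl, fun _ _ => rfl, hp⟩
  have hstep : ∀ p ∈ U, p ∉ Metric.ball ξ ρ₂ → ∃ δ > 0, ∀ q, dist q p < δ → (q ∈ R ↔ p ∈ R) := by
    intro p hp hpb
    obtain ⟨δ₀, hδ₀, hδU⟩ := Metric.isOpen_iff.1 hU p hp
    have hpb' : ρ₂ ≤ dist p ξ := not_lt.1 hpb
    set δ := min (δ₀ / 2) (ρ₂ - ρ₁) with hδ
    have hδ0 : 0 < δ := by
      have : 0 < ρ₂ - ρ₁ := sub_pos.2 hρ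
      positivity
    have hKU : Metric.closedBall p δ ⊆ U := (Metric.closedBall_subset_ball
      ((min_le_left _ _).trans_lt (by linarith))).trans hδU
    have hfar : ∀ z ∈ Metric.closedBall ξ ρ₁, δ ≤ dist z p := fun z hz => by
      have h1 : dist z ξ ≤ ρ₁ := hz
      have h2 := dist_triangle_left p ξ z
      have h3 : δ ≤ ρ₂ - ρ₁ := min_le_right _ _
      linarith
    have comp : ∀ (ψ : ℂ ≃ₜ ℂ) (a b : ℂ), (∀ z, δ ≤ dist z p → ψ z = z) → ψ a = b → b ∈ R →
        a ∈ R := by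
      rintro ψ a b hψ hab ⟨φ, K, hK, hKU', hφK, hφ, hφb⟩
      refine ⟨ψ.trans φ, K ∪ Metric.closedBall p δ, hK.union (isCompact_closedBall _ _),
        union_subset hKU' hKU, fun z hz => ?_, fun z hz => ?_, ?_⟩
      · rw [mem_union, not_or] at hz
        change φ (ψ z) = z
        rw [hψ z (not_le.1 hz.2).le, hφK z hz.1]
      · change φ (ψ z) = z
        rw [hψ z (hfar z hz), hφ z hz]
      · change φ (ψ a) ∈ _
        rw [hab]; exact hφb
    refine ⟨δ, hδ0, fun q hq => ?_⟩
    obtain ⟨ψ, hψp, hψ⟩ := exists_homeomorph_move hq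
    refine ⟨comp ψ p q hψ hψp, comp ψ.symm q p (fun z hz => ?_) ?_⟩
    · rw [Homeomorph.symm_apply_eq, hψ z hz]
    · rw [Homeomorph.symm_apply_eq, hψp]
  have hRU : U ⊆ interior R := by
    refine hUc.subset_of_closure_inter_subset isOpen_interior ⟨ξ, hball (Metric.mem_ball_self hρ₂),
      mem_interior.2 ⟨_, hbR, Metric.isOpen_ball, Metric.mem_ball_self hρ₂⟩⟩ ?_
    rintro p ⟨hpc, hpU⟩
    by_cases hpb : p ∈ Metric.ball ξ ρ₂
    · exact mem_interior.2 ⟨_, hbR, Metric.isOpen_ball, hpb⟩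
    · obtain ⟨δ, hδ, h⟩ := hstep p hpU hpb
      obtain ⟨q, hqR, hqp⟩ := Metric.mem_closure_iff.1 hpc δ hδ
      have hp : p ∈ R := (h q (by rwa [dist_comm])).1 (interior_subset hqR)
      exact mem_interior.2 ⟨Metric.ball p δ, fun x hx => (h x hx).2 hp, Metric.isOpen_ball,
        Metric.mem_ball_self hδ⟩
  have hsR : s ∈ R := interior_subset (hRU hs)
  exact hsR

/-- A finite subset of a domain can be moved into a disc by a homeomorphism supported in a compact
subset of the domain. -/
theorem exists_homeomorph_image_subset_ball {U : Set ℂ} (hU : IsOpen U) (hUc : IsPreconnected U)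
    {ξ : ℂ} {ρ₁ ρ₂ : ℝ} (hρ : ρ₁ < ρ₂) (hρ₂ : 0 < ρ₂) (hball : Metric.ball ξ ρ₂ ⊆ U) {S : Set ℂ}
    (hS : S.Finite) (hSU : S ⊆ U) :
    ∃ (φ : ℂ ≃ₜ ℂ) (K : Set ℂ), IsCompact K ∧ K ⊆ U ∧ (∀ z ∉ K, φ z = z) ∧
      (∀ z ∈ Metric.closedBall ξ ρ₁, φ z = z) ∧ ∀ s ∈ S, φ s ∈ Metric.ball ξ ρ₂ := by
  induction S, hS using Set.Finite.induction_on with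
  | empty => exact ⟨Homeomorph.refl ℂ, ∅, isCompact_empty, empty_subset _, fun _ _ => rfl,
      fun _ _ => rfl, by simp⟩
  | @insert a S _ hS ih =>
    obtain ⟨φ, K, hK, hKU, hφK, hφ, hφS⟩ := ih ((subset_insert a S).trans hSU)
    obtain ⟨ρ, hρ', hSρ⟩ : ∃ ρ < ρ₂, ∀ s ∈ S, dist (φ s) ξ ≤ ρ := by
      rcases S.eq_empty_or_nonempty with rfl | hne
      · exact ⟨ρ₁, hρ, by simp⟩
      · obtain ⟨s, hs, hmax⟩ := hS.exists_maximalFor (fun s => dist (φ s) ξ) S hne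
        exact ⟨dist (φ s) ξ, hφS s hs, fun t ht => (le_total _ _).elim id fun h => hmax ht h⟩
    have hφa : φ a ∈ U := by
      by_cases ha : φ a ∈ K
      · exact hKU ha
      · have : φ (φ a) = φ a := hφK _ ha
        rw [φ.injective this]; exact hSU (mem_insert a S)
    obtain ⟨ψ, K', hK', hK'U, hψK, hψ, hψa⟩ := exists_homeomorph_mem_ball hU hUc
      (max_lt hρ hρ') hρ₂ hball hφa
    refine ⟨φ.trans ψ, K ∪ K', hK.union hK', union_subset hKU hK'U, fun z hz => ?_, fun z hz => ?_,
      fun s hs => ?_⟩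
    · rw [mem_union, not_or] at hz
      change ψ (φ z) = z
      rw [hφK z hz.1, hψK z hz.2]
    · change ψ (φ z) = z
      rw [hφ z hz, hψ z (Metric.closedBall_subset_closedBall (le_max_left _ _) hz)]
    · change ψ (φ s) ∈ _
      rcases hs with rfl | hs
      · exact hψa
      · have h1 : φ s ∈ Metric.closedBall ξ (max ρ₁ ρ) := (hSρ s hs).trans (le_max_right _ _)
        rw [hψ _ h1]; exact hφS s hs

/-- `F` is locally biholomorphic on the open set `O`, and paths in `Q` lift through `F` to paths in
`O` with any prescribed starting point. -/
structure IsConformalCovering (F : ℂ → ℂ) (O Q : Set ℂ) : Prop where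
  isOpen : IsOpen O
  analyticAt : ∀ z ∈ O, AnalyticAt ℂ F z
  deriv_ne_zero : ∀ z ∈ O, deriv F z ≠ 0
  mapsTo : MapsTo F O Q
  exists_lift : ∀ γ : ℝ → ℂ, ContinuousOn γ (Icc 0 1) → MapsTo γ (Icc 0 1) Q → ∀ z ∈ O,
    F z = γ 0 → ∃ Γ : ℝ → ℂ, ContinuousOn Γ (Icc 0 1) ∧ Γ 0 = z ∧
      ∀ t ∈ Icc (0 : ℝ) 1, Γ t ∈ O ∧ F (Γ t) = γ t

theorem isLocalHomeomorph_restrict {F : ℂ → ℂ} {O : Set ℂ} (hO : IsOpen O)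
    (ha : ∀ z ∈ O, AnalyticAt ℂ F z) (hd : ∀ z ∈ O, deriv F z ≠ 0) :
    IsLocalHomeomorph (fun z : O => F z) := by
  have h1 : IsLocalHomeomorphOn F O := IsLocalHomeomorphOn.mk F O fun z hz => by
    have hs := ((ha z hz).hasStrictDerivAt).hasStrictFDerivAt_equiv (hd z hz)
    exact ⟨hs.toOpenPartialHomeomorph F, hs.mem_toOpenPartialHomeomorph_source, fun _ _ => rfl⟩
  have h2 : IsLocalHomeomorph (Subtype.val : O → ℂ) :=
    hO.isOpenEmbedding_subtypeVal.isLocalHomeomorph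
  rw [isLocalHomeomorph_iff_isLocalHomeomorphOn_univ] at h2 ⊢
  exact h1.comp h2 fun z _ => z.2

/-- Uniqueness of lifts through a locally biholomorphic map. -/
theorem eqOn_of_comp_eqOn {α : Type*} [TopologicalSpace α] {F : ℂ → ℂ} {O : Set ℂ} (hO : IsOpen O)
    (ha : ∀ z ∈ O, AnalyticAt ℂ F z) (hd : ∀ z ∈ O, deriv F z ≠ 0) {A : Set α}
    (hA : IsPreconnected A) {g₁ g₂ : α → ℂ} (h₁ : ContinuousOn g₁ A) (h₂ : ContinuousOn g₂ A)
    (hm₁ : MapsTo g₁ A O) (hm₂ : MapsTo g₂ A O) (he : EqOn (F ∘ g₁) (F ∘ g₂) A) {a : α}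
    (haA : a ∈ A) (hag : g₁ a = g₂ a) : EqOn g₁ g₂ A := by
  have hl := isLocalHomeomorph_restrict hO ha hd
  have : PreconnectedSpace A := isPreconnected_iff_preconnectedSpace.1 hA
  have key := (T2Space.isSeparatedMap (fun z : O => F z)).eq_of_comp_eq hl.isLocallyInjective
    (A := A) (g₁ := fun x : A => (⟨g₁ x, hm₁ x.2⟩ : O))
    (g₂ := fun x : A => (⟨g₂ x, hm₂ x.2⟩ : O))
    (by rw [continuousOn_iff_continuous_domRestrict] at h₁; exact h₁.subtype_mk _)
    (by rw [continuousOn_iff_continuous_domRestrict] at h₂; exact h₂.subtype_mk _)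
    (funext fun x => he x.2) ⟨a, haA⟩ (Subtype.ext hag)
  exact fun x hx => congrArg Subtype.val (congrFun key ⟨x, hx⟩)

/-- A continuous right inverse of a locally biholomorphic map is holomorphic. -/
theorem hasDerivAt_of_rightInverse {F G : ℂ → ℂ} {w : ℂ} (hG : ContinuousAt G w)
    (ha : AnalyticAt ℂ F (G w)) (hd : deriv F (G w) ≠ 0) (h : ∀ᶠ y in 𝓝 w, F (G y) = y) :
    HasDerivAt G (deriv F (G w))⁻¹ w :=
  HasDerivAt.of_local_left_inverse hG ha.differentiableAt.hasDerivAt hd h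

namespace IsConformalCovering

variable {F f : ℂ → ℂ} {O Q O₁ Q₁ : Set ℂ}

theorem id_of_isOpen (hQ : IsOpen Q) : IsConformalCovering id Q Q where
  isOpen := hQ
  analyticAt _ _ := analyticAt_id
  deriv_ne_zero z _ := by simp
  mapsTo := mapsTo_id _
  exists_lift γ hγ hγQ z _ hzγ := ⟨γ, hγ, hzγ.symm, fun t ht => ⟨hγQ ht, rfl⟩⟩

theorem comp (hF : IsConformalCovering F O Q) (hf : IsConformalCovering f O₁ Q₁) (hOQ : O ⊆ Q₁) :
    IsConformalCovering (F ∘ f) (O₁ ∩ f ⁻¹' O) Q where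
  isOpen := by
    have : ContinuousOn f O₁ := fun z hz => (hf.analyticAt z hz).continuousAt.continuousWithinAt
    exact this.isOpen_inter_preimage hf.isOpen hF.isOpen
  analyticAt z hz := (hF.analyticAt _ hz.2).comp (hf.analyticAt z hz.1)
  deriv_ne_zero z hz := by
    rw [deriv_comp z (hF.analyticAt _ hz.2).differentiableAt
      (hf.analyticAt z hz.1).differentiableAt]
    exact mul_ne_zero (hF.deriv_ne_zero _ hz.2) (hf.deriv_ne_zero z hz.1)
  mapsTo z hz := hF.mapsTo hz.2
  exists_lift γ hγ hγQ z hz hzγ := by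
    obtain ⟨Γ, hΓ, hΓ0, hΓl⟩ := hF.exists_lift γ hγ hγQ (f z) hz.2 hzγ
    obtain ⟨Δ, hΔ, hΔ0, hΔl⟩ := hf.exists_lift Γ hΓ (fun t ht => hOQ (hΓl t ht).1) z hz.1 hΓ0.symm
    refine ⟨Δ, hΔ, hΔ0, fun t ht => ⟨⟨(hΔl t ht).1, ?_⟩, ?_⟩⟩
    · change f (Δ t) ∈ O
      rw [(hΔl t ht).2]; exact (hΓl t ht).1
    · change F (f (Δ t)) = _
      rw [(hΔl t ht).2, (hΓl t ht).2]

/-- Maps from convex sets lift. -/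
theorem exists_lift_of_convex (hF : IsConformalCovering F O Q) {A : Set ℂ} (hA : Convex ℝ A)
    {E : ℂ → ℂ} (hE : ContinuousOn E A) (hEQ : MapsTo E A Q) {a₀ z₀ : ℂ} (ha₀ : a₀ ∈ A)
    (hz₀ : z₀ ∈ O) (h : F z₀ = E a₀) :
    ∃ Φ : ℂ → ℂ, ContinuousOn Φ A ∧ Φ a₀ = z₀ ∧ ∀ a ∈ A, Φ a ∈ O ∧ F (Φ a) = E a := by
  classical
  have hseg : ∀ (t : unitInterval) (a : A), AffineMap.lineMap a₀ (a : ℂ) (t : ℝ) ∈ A := fun t a =>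
    hA.segment_subset ha₀ a.2 (segment_eq_image_lineMap ℝ a₀ (a : ℂ) ▸ ⟨t, t.2, rfl⟩)
  have hex : ∀ a : A, ∃ Γ : ℝ → ℂ, ContinuousOn Γ (Icc 0 1) ∧ Γ 0 = z₀ ∧
      ∀ t ∈ Icc (0 : ℝ) 1, Γ t ∈ O ∧ F (Γ t) = E (AffineMap.lineMap a₀ (a : ℂ) t) := fun a =>
    hF.exists_lift (fun t => E (AffineMap.lineMap a₀ (a : ℂ) t))
      (hE.comp (AffineMap.lineMap_continuous.continuousOn) fun t ht => hseg ⟨t, ht⟩ a)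
      (fun t ht => hEQ (hseg ⟨t, ht⟩ a)) z₀ hz₀ (by simpa using h)
  choose Γ hΓ hΓ0 hΓl using hex
  have hcont : Continuous fun x : unitInterval × A =>
      (⟨Γ x.2 x.1, (hΓl x.2 x.1 x.1.2).1⟩ : O) := by
    refine (isLocalHomeomorph_restrict hF.isOpen hF.analyticAt hF.deriv_ne_zero).continuous_lift
      (T2Space.isSeparatedMap _)
      (⟨fun x : unitInterval × A => E (AffineMap.lineMap a₀ (x.2 : ℂ) (x.1 : ℝ)), ?_⟩) ?_ ?_ ?_
    · refine hE.comp_continuous ?_ fun x => hseg x.1 x.2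
      simp only [AffineMap.lineMap_apply_module]
      fun_prop
    · funext x
      exact (hΓl x.2 x.1 x.1.2).2
    · have : (fun a : A => (⟨Γ a (0 : unitInterval), (hΓl a 0 (0 : unitInterval).2).1⟩ : O)) =
          fun _ => ⟨z₀, hz₀⟩ := by
        funext a; exact Subtype.ext (hΓ0 a)
      exact this ▸ continuous_const
    · intro a
      exact Continuous.subtype_mk ((hΓ a).comp_continuous continuous_subtype_val fun t => t.2) _
  have h1 : (1 : ℝ) ∈ Icc (0 : ℝ) 1 := ⟨zero_le_one, le_rfl⟩
  refine ⟨fun a => if ha : a ∈ A then Γ ⟨a, ha⟩ 1 else z₀, ?_, ?_, ?_⟩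
  · rw [continuousOn_iff_continuous_domRestrict]
    have h2 : Continuous fun a : A => Γ a 1 :=
      continuous_subtype_val.comp (hcont.comp (Continuous.prodMk_right (1 : unitInterval)))
    convert! h2 using 1
    funext a
    simp
  · have huniq := eqOn_of_comp_eqOn hF.isOpen hF.analyticAt hF.deriv_ne_zero
      (isPreconnected_Icc (a := (0 : ℝ)) (b := 1)) (hΓ ⟨a₀, ha₀⟩)
      (continuousOn_const (c := z₀)) (fun t ht => (hΓl ⟨a₀, ha₀⟩ t ht).1) (fun _ _ => hz₀)
      (fun t ht => by
        change F (Γ ⟨a₀, ha₀⟩ t) = F z₀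
        rw [(hΓl ⟨a₀, ha₀⟩ t ht).2, AffineMap.lineMap_same_apply, h])
      (left_mem_Icc.2 zero_le_one) (hΓ0 _)
    simp only [dif_pos ha₀]
    exact huniq h1
  · intro a ha
    simp only [dif_pos ha]
    have := hΓl ⟨a, ha⟩ 1 h1
    rwa [AffineMap.lineMap_apply_one] at this

theorem eqOn_of_lifts (hF : IsConformalCovering F O Q) {A : Set ℂ} (hA : IsPreconnected A)
    {g₁ g₂ E : ℂ → ℂ} (h₁ : ContinuousOn g₁ A) (h₂ : ContinuousOn g₂ A)
    (hl₁ : ∀ a ∈ A, g₁ a ∈ O ∧ F (g₁ a) = E a) (hl₂ : ∀ a ∈ A, g₂ a ∈ O ∧ F (g₂ a) = E a) {a : ℂ}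
    (haA : a ∈ A) (hag : g₁ a = g₂ a) : EqOn g₁ g₂ A :=
  eqOn_of_comp_eqOn hF.isOpen hF.analyticAt hF.deriv_ne_zero hA h₁ h₂ (fun a ha => (hl₁ a ha).1)
    (fun a ha => (hl₂ a ha).1) (fun a ha => (hl₁ a ha).2.trans (hl₂ a ha).2.symm) haA hag

/-- Inverse branches on discs. -/
theorem exists_inverse_branch (hF : IsConformalCovering F O Q) {z₀ : ℂ} {ρ : ℝ} (hρ : 0 < ρ)
    (hz₀ : z₀ ∈ O) (hball : Metric.ball (F z₀) ρ ⊆ Q) :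
    ∃ G : ℂ → ℂ, G (F z₀) = z₀ ∧ (∀ y ∈ Metric.ball (F z₀) ρ, G y ∈ O ∧ F (G y) = y) ∧
      ∀ y ∈ Metric.ball (F z₀) ρ, HasDerivAt G (deriv F (G y))⁻¹ y := by
  obtain ⟨G, hG, hG0, hGl⟩ := hF.exists_lift_of_convex (convex_ball (F z₀) ρ) continuousOn_id hball
    (Metric.mem_ball_self hρ) hz₀ rfl
  refine ⟨G, hG0, hGl, fun y hy => ?_⟩
  have hn := Metric.isOpen_ball.mem_nhds hy
  exact hasDerivAt_of_rightInverse (hG.continuousAt hn) (hF.analyticAt _ (hGl y hy).1)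
    (hF.deriv_ne_zero _ (hGl y hy).1) (by filter_upwards [hn] with x hx using (hGl x hx).2)

/-- The lift of an open map is open. -/
theorem isOpen_image_lift (hF : IsConformalCovering F O Q) {A : Set ℂ} (hA : IsOpen A) {E : ℂ → ℂ}
    (hE : ∀ B ⊆ A, IsOpen B → IsOpen (E '' B)) {Φ : ℂ → ℂ} (hΦ : ContinuousOn Φ A)
    (hΦl : ∀ a ∈ A, Φ a ∈ O ∧ F (Φ a) = E a) : IsOpen (Φ '' A) := by
  rw [isOpen_iff_mem_nhds]
  rintro _ ⟨a, ha, rfl⟩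
  have hs := ((hF.analyticAt _ (hΦl a ha).1).hasStrictDerivAt).hasStrictFDerivAt_equiv
    (hF.deriv_ne_zero _ (hΦl a ha).1)
  set e := hs.toOpenPartialHomeomorph F with he
  have hemem : Φ a ∈ e.source := hs.mem_toOpenPartialHomeomorph_source
  have hB : IsOpen (A ∩ Φ ⁻¹' e.source) := hΦ.isOpen_inter_preimage hA e.open_source
  have hEB := hE _ inter_subset_left hB
  have hmem : E a ∈ E '' (A ∩ Φ ⁻¹' e.source) := ⟨a, ⟨ha, hemem⟩, rfl⟩
  have hc : ContinuousAt F (Φ a) := (hF.analyticAt _ (hΦl a ha).1).continuousAt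
  have h1 : F ⁻¹' (E '' (A ∩ Φ ⁻¹' e.source)) ∈ 𝓝 (Φ a) :=
    hc (by rw [(hΦl a ha).2]; exact hEB.mem_nhds hmem)
  filter_upwards [h1, e.open_source.mem_nhds hemem] with y ⟨b, ⟨hbA, hbs⟩, hby⟩ hys
  refine ⟨b, hbA, e.injOn hbs hys ?_⟩
  change F (Φ b) = F y
  rw [(hΦl b hbA).2, hby]

end IsConformalCovering

section Meromorphic

variable {f : ℂ → ℂ}

theorem analyticAt_of_not_isPole (hf : MeromorphicNFOn f univ) {z : ℂ} (hz : ¬ IsPole f z) :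
    AnalyticAt ℂ f z :=
  (hf (mem_univ z)).meromorphicOrderAt_nonneg_iff_analyticAt.1 (not_lt.1 hz)

theorem not_isPole_of_analyticAt {z : ℂ} (hz : AnalyticAt ℂ f z) : ¬ IsPole f z :=
  not_lt.2 hz.meromorphicOrderAt_nonneg

theorem eventually_not_isPole (hf : MeromorphicNFOn f univ) (z : ℂ) :
    ∀ᶠ y in 𝓝[≠] z, ¬ IsPole f y := by
  filter_upwards [(hf (mem_univ z)).meromorphicAt.eventually_analyticAt] with y hy
  exact not_isPole_of_analyticAt hy

theorem isOpen_not_isPole (hf : MeromorphicNFOn f univ) : IsOpen {z | ¬ IsPole f z} := by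
  rw [isOpen_iff_mem_nhds]
  intro z hz
  filter_upwards [(analyticAt_of_not_isPole hf hz).eventually_analyticAt] with y hy
  exact not_isPole_of_analyticAt hy

theorem toSphere_of_isPole {z : ℂ} (hz : IsPole f z) : toSphere f z = OnePoint.infty := by
  classical
  exact if_pos hz

theorem toSphere_of_not_isPole {z : ℂ} (hz : ¬ IsPole f z) : toSphere f z = (f z : OnePoint ℂ) := by
  classical
  exact if_neg hz

theorem toSphere_eq_coe_iff {z w : ℂ} :
    toSphere f z = (w : OnePoint ℂ) ↔ ¬ IsPole f z ∧ f z = w := by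
  by_cases hz : IsPole f z
  · simp [toSphere_of_isPole hz, hz]
  · simp [toSphere_of_not_isPole hz, hz]

theorem toSphere_eq_infty_iff {z : ℂ} : toSphere f z = OnePoint.infty ↔ IsPole f z := by
  by_cases hz : IsPole f z
  · simp [toSphere_of_isPole hz, hz]
  · simp [toSphere_of_not_isPole hz, hz]

theorem continuous_toSphere (hf : MeromorphicNFOn f univ) : Continuous (toSphere f) := by
  rw [continuous_iff_continuousAt]
  intro z
  by_cases hz : IsPole f z
  · have h1 : Tendsto f (𝓝[≠] z) (Bornology.cobounded ℂ) :=
      tendsto_cobounded_of_meromorphicOrderAt_neg hz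
    rw [Metric.cobounded_eq_cocompact, ← coclosedCompact_eq_cocompact] at h1
    have h2 : Tendsto (toSphere f) (𝓝[≠] z) (𝓝 (toSphere f z)) := by
      rw [toSphere_of_isPole hz]
      refine (OnePoint.tendsto_coe_infty.comp h1).congr' ?_
      filter_upwards [eventually_not_isPole hf z] with y hy using (toSphere_of_not_isPole hy).symm
    exact continuousAt_iff_punctured_nhds.2 h2
  · have h1 : ContinuousAt f z := (analyticAt_of_not_isPole hf hz).continuousAt
    have h2 : ContinuousAt (fun y => (f y : OnePoint ℂ)) z :=
      OnePoint.continuous_coe.continuousAt.comp h1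
    refine h2.congr ?_
    filter_upwards [(isOpen_not_isPole hf).mem_nhds hz] with y hy
      using (toSphere_of_not_isPole hy).symm

theorem meromorphicOrderAt_sub_const_ne_top (hf : MeromorphicNFOn f univ) (hr : ¬ IsRational f)
    (w z : ℂ) : meromorphicOrderAt (fun y => f y - w) z ≠ ⊤ := by
  intro htop
  have hm : MeromorphicOn (fun y => f y - w) univ := fun x _ =>
    (hf (mem_univ x)).meromorphicAt.sub (MeromorphicAt.const w x)
  have hall : ∀ x, meromorphicOrderAt (fun y => f y - w) x = ⊤ := fun x => by
    by_contra hx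
    exact hm.meromorphicOrderAt_ne_top_of_isPreconnected isPreconnected_univ (mem_univ x)
      (mem_univ z) hx htop
  refine hr ⟨Polynomial.C w, 1, one_ne_zero, fun x _ => ?_⟩
  have h1 : f =ᶠ[𝓝[≠] x] fun _ => w := by
    filter_upwards [meromorphicOrderAt_eq_top_iff.1 (hall x)] with y hy using sub_eq_zero.1 hy
  have h2 := ((hf (mem_univ x)).eventuallyEq_nhdsNE_iff_eventuallyEq_nhds
    (analyticAt_const (v := w)).meromorphicNFAt).1 h1
  simpa using h2.eq_of_nhds

theorem eventually_toSphere_ne (hf : MeromorphicNFOn f univ) (hr : ¬ IsRational f) (z : ℂ)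
    (a : OnePoint ℂ) : ∀ᶠ y in 𝓝[≠] z, toSphere f y ≠ a := by
  induction a using OnePoint.rec with
  | infty =>
    filter_upwards [eventually_not_isPole hf z] with y hy h using hy (toSphere_eq_infty_iff.1 h)
  | coe w =>
    have hm : MeromorphicAt (fun y => f y - w) z :=
      (hf (mem_univ z)).meromorphicAt.sub (MeromorphicAt.const w z)
    filter_upwards [(meromorphicOrderAt_ne_top_iff_eventually_ne_zero hm).1
      (meromorphicOrderAt_sub_const_ne_top hf hr w z)] with y hy h
    exact hy (sub_eq_zero.2 (toSphere_eq_coe_iff.1 h).2)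

/-- A path along which `f` has a limit either tends to `∞` or converges. -/
theorem tendsto_cocompact_or_exists_tendsto (hf : MeromorphicNFOn f univ) (hr : ¬ IsRational f)
    {γ : ℝ → ℂ} (hγ : ContinuousOn γ (Ici 0)) {a : OnePoint ℂ}
    (ha : Tendsto (fun t => toSphere f (γ t)) atTop (𝓝 a)) :
    Tendsto γ atTop (cocompact ℂ) ∨ ∃ z, Tendsto γ atTop (𝓝 z) ∧ toSphere f z = a := by
  refine or_iff_not_imp_left.2 fun hnot => ?_
  obtain ⟨K, hK, hfreq⟩ : ∃ K, IsCompact K ∧ ∃ᶠ t in atTop, γ t ∈ K := by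
    rw [(hasBasis_cocompact).tendsto_right_iff] at hnot
    push Not at hnot
    obtain ⟨K, hK, h⟩ := hnot
    exact ⟨K, hK, h.mono fun t ht => not_not.1 ht⟩
  obtain ⟨z, -, hz⟩ := hK.exists_mapClusterPt_of_frequently hfreq
  have hfz : toSphere f z = a := by
    have h1 : MapClusterPt (toSphere f z) atTop (toSphere f ∘ γ) :=
      hz.continuousAt_comp (continuous_toSphere hf).continuousAt
    have h2 : (𝓝 (toSphere f z) ⊓ 𝓝 a).NeBot := NeBot.mono h1 (inf_le_inf_left _ ha)
    exact eq_of_nhds_neBot h2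
  refine ⟨z, Metric.tendsto_nhds.2 fun ε hε => ?_, hfz⟩
  obtain ⟨δ₀, hδ₀, hiso⟩ := Metric.eventually_nhds_iff.1
    (eventually_nhdsWithin_iff.1 (eventually_toSphere_ne hf hr z a))
  set δ := min ε δ₀ / 2 with hδ
  have hm : 0 < min ε δ₀ := lt_min hε hδ₀
  have hδ0 : 0 < δ := by positivity
  have hδlt : δ < min ε δ₀ := by linarith
  have hcomp : IsCompact (toSphere f '' Metric.sphere z δ) :=
    (isCompact_sphere z δ).image (continuous_toSphere hf)
  have hnotin : a ∉ toSphere f '' Metric.sphere z δ := by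
    rintro ⟨y, hy, hya⟩
    have hy' : dist y z = δ := hy
    refine hiso (y := y) (by rw [hy']; exact hδlt.trans_le (min_le_right _ _)) ?_ hya
    intro h
    rw [h, dist_self] at hy'
    exact hδ0.ne hy'
  have hev := ha.eventually (hcomp.isClosed.isOpen_compl.mem_nhds hnotin)
  obtain ⟨t₀, ht₀⟩ := eventually_atTop.1 (hev.and (eventually_ge_atTop 0))
  have hfr : ∃ᶠ t in atTop, γ t ∈ Metric.ball z δ :=
    mapClusterPt_iff_frequently.1 hz _ (Metric.ball_mem_nhds z hδ0)
  obtain ⟨t₁, ht₁, hball⟩ := frequently_atTop.1 hfr t₀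
  have hcont : ContinuousOn (fun t => dist (γ t) z) (Ici t₀) :=
    (continuous_id.dist (continuous_const (y := z))).comp_continuousOn
      (hγ.mono (Ici_subset_Ici.2 (ht₀ t₀ le_rfl).2))
  filter_upwards [eventually_ge_atTop t₀] with t ht
  by_contra hcon
  have hε' : δ ≤ dist (γ t) z := (hδlt.le.trans (min_le_left _ _)).trans (not_lt.1 hcon)
  obtain ⟨s, hs, hsδ⟩ := isPreconnected_Ici.intermediate_value (f := fun t => dist (γ t) z) ht₁ ht
    hcont ⟨le_of_lt hball, hε'⟩
  exact (ht₀ s hs).1 ⟨γ s, hsδ, rfl⟩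

/-- A function in normal form takes each value at most `k` times near a pole of order `k`. -/
theorem exists_nhds_card_le_of_isPole (hf : MeromorphicNFOn f univ) {p : ℂ} (hp : IsPole f p)
    {M : ℕ} (hM : ((-(M : ℤ) : ℤ) : WithTop ℤ) ≤ meromorphicOrderAt f p) :
    ∃ V ∈ 𝓝 p, ∀ (w : ℂ) (T : Finset ℂ), (∀ z ∈ T, z ∈ V ∧ ¬ IsPole f z ∧ f z = w) →
      T.card ≤ M := by
  classical
  have hp' : meromorphicOrderAt f p < 0 := hp
  obtain ⟨n, hn⟩ := WithTop.ne_top_iff_exists.1 hp'.ne_top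
  rw [← hn] at hM hp'
  have hn0 : n < 0 := by exact_mod_cast hp'
  have hnM : -(M : ℤ) ≤ n := by exact_mod_cast hM
  obtain ⟨k, rfl⟩ : ∃ k : ℕ, n = -(k : ℤ) := ⟨n.natAbs, by omega⟩
  have hk : k ≠ 0 := by omega
  obtain ⟨g, hg, hgp, hfg⟩ :=
    (meromorphicOrderAt_eq_int_iff (hf (mem_univ p)).meromorphicAt).1 hn.symm
  set ψ : ℂ → ℂ := fun z => (z - p) * Complex.exp (-(1 / k) * Complex.log (g z / g p)) with hψ
  have hslit : g p / g p ∈ Complex.slitPlane := by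
    rw [div_self hgp]; exact Complex.one_mem_slitPlane
  have hha : AnalyticAt ℂ (fun z => Complex.exp (-(1 / k) * Complex.log (g z / g p))) p :=
    (analyticAt_const.mul ((hg.div analyticAt_const hgp).clog hslit)).cexp
  have hψa : AnalyticAt ℂ ψ p := (analyticAt_id.sub analyticAt_const).mul hha
  have hψd : deriv ψ p ≠ 0 := by
    have h1 := ((hasDerivAt_id p).sub_const p).mul hha.differentiableAt.hasDerivAt
    have h2 : HasDerivAt ψ _ p := h1
    rw [h2.deriv]
    simp
  have hs := hψa.hasStrictDerivAt.hasStrictFDerivAt_equiv hψd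
  set e := hs.toOpenPartialHomeomorph ψ
  have hV : ∀ᶠ z in 𝓝 p, z ∈ e.source ∧ (z ≠ p → f z = (z - p) ^ (-(k : ℤ)) • g z) ∧ g z ≠ 0 :=
    (e.open_source.eventually_mem hs.mem_toOpenPartialHomeomorph_source).and
      ((eventually_nhdsWithin_iff.1 hfg).and (hg.continuousAt.eventually_ne hgp))
  refine ⟨_, hV, fun w T hT => ?_⟩
  have hzp : ∀ z ∈ T, z ≠ p := fun z hz h => (hT z hz).2.1 (h ▸ hp)
  have hpow : ∀ z ∈ T, ψ z ^ k = g p / w := fun z hz => by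
    obtain ⟨⟨-, h1, h2⟩, -, h3⟩ := hT z hz
    have h4 := sub_ne_zero.2 (hzp z hz)
    rw [← h3, h1 (hzp z hz), hψ]
    simp only
    rw [mul_pow, ← Complex.exp_nat_mul, ← mul_assoc]
    have hkc : (k : ℂ) ≠ 0 := by exact_mod_cast hk
    have h5 : (k : ℂ) * -(1 / k) = -1 := by field_simp
    rw [h5, neg_one_mul, Complex.exp_neg, Complex.exp_log (div_ne_zero h2 hgp), zpow_neg,
      zpow_natCast, smul_eq_mul]
    field_simp
  have hinj : InjOn ψ (T : Set ℂ) := fun x hx y hy hxy => e.injOn (hT x hx).1.1 (hT y hy).1.1 hxy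
  have hsub : T.image ψ ⊆ (Polynomial.nthRoots k (g p / w)).toFinset := fun y hy => by
    obtain ⟨z, hz, rfl⟩ := Finset.mem_image.1 hy
    rw [Multiset.mem_toFinset, Polynomial.mem_nthRoots (Nat.pos_of_ne_zero hk)]
    exact hpow z hz
  calc T.card = (T.image ψ).card := (Finset.card_image_of_injOn hinj).symm
    _ ≤ _ := Finset.card_le_card hsub
    _ ≤ Multiset.card (Polynomial.nthRoots k (g p / w)) := Multiset.toFinset_card_le _
    _ ≤ k := Polynomial.card_nthRoots _ _
    _ ≤ M := by omega

end Meromorphic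

section Lifting

variable {f : ℂ → ℂ}

theorem deriv_ne_zero_of_notMem_singInv {z : ℂ} (hz : ¬ IsPole f z)
    (h : (f z : OnePoint ℂ) ∉ singInv f) : deriv f z ≠ 0 := fun hd =>
  h (Or.inl ⟨z, Or.inl ⟨hz, hd⟩, toSphere_of_not_isPole hz⟩)

/-- A lift through `f` of a path defined on a half-open interval converges at the open end, unless
the path ends at an asymptotic value. -/
theorem exists_tendsto_of_lift (hf : MeromorphicNFOn f univ) (hr : ¬ IsRational f) {γ Γ : ℝ → ℂ}
    {τ : ℝ} (hτ : 0 < τ) (hΓ : ContinuousOn Γ (Ico 0 τ)) (hγ : Tendsto γ (𝓝[<] τ) (𝓝 (γ τ)))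
    (hl : ∀ t ∈ Ico 0 τ, ¬ IsPole f (Γ t) ∧ f (Γ t) = γ t)
    (has : ¬ IsAsymptoticValue f (γ τ : OnePoint ℂ)) :
    ∃ z, Tendsto Γ (𝓝[<] τ) (𝓝 z) ∧ ¬ IsPole f z ∧ f z = γ τ := by
  set σ : ℝ → ℝ := fun x => τ * (x / (1 + x)) with hσ
  have hσm : ∀ x ∈ Ici (0 : ℝ), σ x ∈ Ico 0 τ := fun x hx => by
    have hx' : (0 : ℝ) ≤ x := hx
    refine ⟨by positivity, ?_⟩
    have : x / (1 + x) < 1 := by rw [div_lt_one (by linarith)]; linarith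
    nlinarith
  have hσc : ContinuousOn σ (Ici 0) := by
    refine continuousOn_const.mul (continuousOn_id.div (by fun_prop) fun x hx => ?_)
    have hx' : (0 : ℝ) ≤ x := hx
    positivity
  have hσt : Tendsto σ atTop (𝓝[<] τ) := by
    refine tendsto_nhdsWithin_iff.2 ⟨?_, ?_⟩
    · have h1 : Tendsto (fun x : ℝ => τ * (1 - (1 + x)⁻¹)) atTop (𝓝 (τ * (1 - 0))) :=
        ((tendsto_inv_atTop_zero.comp (tendsto_atTop_add_const_left _ 1 tendsto_id)).const_sub
          1).const_mul τ
      rw [sub_zero, mul_one] at h1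
      refine h1.congr' ?_
      filter_upwards [eventually_ge_atTop 0] with x hx
      have : 1 + x ≠ 0 := by positivity
      simp only [hσ]
      field_simp
      ring
    · filter_upwards [eventually_ge_atTop 0] with x hx using (hσm x hx).2
  have hΔ : ContinuousOn (Γ ∘ σ) (Ici 0) := hΓ.comp hσc hσm
  have hlim : Tendsto (fun x => toSphere f ((Γ ∘ σ) x)) atTop (𝓝 (γ τ : OnePoint ℂ)) := by
    have h1 : Tendsto (fun x => (γ (σ x) : OnePoint ℂ)) atTop (𝓝 (γ τ : OnePoint ℂ)) :=
      (OnePoint.continuous_coe.tendsto _).comp (hγ.comp hσt)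
    refine h1.congr' ?_
    filter_upwards [eventually_ge_atTop 0] with x hx
    have := hl _ (hσm x hx)
    rw [← this.2]
    exact (toSphere_of_not_isPole this.1).symm
  rcases tendsto_cocompact_or_exists_tendsto hf hr hΔ hlim with h | ⟨z, hz, hzf⟩
  · exact absurd ⟨Γ ∘ σ, hΔ, h, hlim⟩ has
  · refine ⟨z, ?_, toSphere_eq_coe_iff.1 hzf⟩
    have h1 : Tendsto (fun s : ℝ => s / (τ - s)) (𝓝[<] τ) atTop := by
      have h2 : Tendsto (fun s : ℝ => (τ - s)⁻¹) (𝓝[<] τ) atTop := by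
        refine tendsto_inv_nhdsGT_zero.comp (tendsto_nhdsWithin_iff.2 ⟨?_, ?_⟩)
        · have : Tendsto (fun s : ℝ => τ - s) (𝓝 τ) (𝓝 (τ - τ)) := tendsto_const_nhds.sub tendsto_id
          rw [sub_self] at this
          exact this.mono_left nhdsWithin_le_nhds
        · filter_upwards [self_mem_nhdsWithin] with s hs using sub_pos.2 (show s < τ from hs)
      have h3 : Tendsto (fun s : ℝ => s) (𝓝[<] τ) (𝓝 τ) := tendsto_id.mono_left nhdsWithin_le_nhds
      exact h3.pos_mul_atTop hτ h2
    refine (hz.comp h1).congr' ?_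
    filter_upwards [self_mem_nhdsWithin] with s hs
    have hs' : τ - s ≠ 0 := (sub_pos.2 (show s < τ from hs)).ne'
    simp only [Function.comp, hσ]
    congr 1
    have : 1 + s / (τ - s) = τ / (τ - s) := by field_simp; ring
    rw [this]
    field_simp

/-- A meromorphic function is a covering over any open set without singular values. -/
theorem isConformalCovering_of_singInv (hf : MeromorphicNFOn f univ) (hr : ¬ IsRational f)
    {P : Set ℂ} (hP : IsClosed P) (hs : ∀ a : ℂ, (a : OnePoint ℂ) ∈ singInv f → a ∈ P) :
    IsConformalCovering f {z | ¬ IsPole f z ∧ f z ∉ P} Pᶜ := by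
  set O : Set ℂ := {z | ¬ IsPole f z ∧ f z ∉ P} with hO
  have hOo : IsOpen O := by
    have : ContinuousOn f {z | ¬ IsPole f z} := fun z hz =>
      (analyticAt_of_not_isPole hf hz).continuousAt.continuousWithinAt
    exact this.isOpen_inter_preimage (isOpen_not_isPole hf) hP.isOpen_compl
  have hOa : ∀ z ∈ O, AnalyticAt ℂ f z := fun z hz => analyticAt_of_not_isPole hf hz.1
  have hOd : ∀ z ∈ O, deriv f z ≠ 0 := fun z hz =>
    deriv_ne_zero_of_notMem_singInv hz.1 fun h => hz.2 (hs _ h)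
  refine ⟨hOo, hOa, hOd, fun z hz => hz.2, fun γ hγ hγP z hz hzγ => ?_⟩
  set T : Set ℝ := {t | ∃ Γ : ℝ → ℂ, ContinuousOn Γ (Icc 0 t) ∧ Γ 0 = z ∧
    ∀ s ∈ Icc 0 t, Γ s ∈ O ∧ f (Γ s) = γ s} with hT
  have hdown : ∀ s t, s ≤ t → t ∈ T → s ∈ T := by
    rintro s t hst ⟨Γ, h1, h2, h3⟩
    exact ⟨Γ, h1.mono (Icc_subset_Icc_right hst), h2, fun x hx => h3 x ⟨hx.1, hx.2.trans hst⟩⟩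
  have h0T : (0 : ℝ) ∈ T := by
    refine ⟨fun _ => z, continuousOn_const, rfl, fun s hs => ?_⟩
    obtain rfl : s = 0 := le_antisymm hs.2 hs.1
    exact ⟨hz, hzγ⟩
  have hlimit : ∀ t ∈ Ioc (0 : ℝ) 1, (∀ s, s < t → s ∈ T) → t ∈ T := by
    intro t ht hlt
    choose! Γ hΓ hΓ0 hΓl using hlt
    have hag : ∀ s s', 0 ≤ s → s ≤ s' → s' < t → Γ s s = Γ s' s := fun s s' h0 h1 h2 =>
      eqOn_of_comp_eqOn hOo hOa hOd isPreconnected_Icc (hΓ s (h1.trans_lt h2))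
        ((hΓ s' h2).mono (Icc_subset_Icc_right h1))
        (fun x hx => (hΓl s (h1.trans_lt h2) x hx).1)
        (fun x hx => (hΓl s' h2 x ⟨hx.1, hx.2.trans h1⟩).1)
        (fun x hx => (hΓl s (h1.trans_lt h2) x hx).2.trans
          (hΓl s' h2 x ⟨hx.1, hx.2.trans h1⟩).2.symm)
        (left_mem_Icc.2 h0) ((hΓ0 s (h1.trans_lt h2)).trans (hΓ0 s' h2).symm)
        (right_mem_Icc.2 h0)
    have hcont : ContinuousOn (fun s => Γ s s) (Ico 0 t) := by
      intro s hs
      set s' := (s + t) / 2 with hs'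
      have h1 : s < s' := by linarith [hs.2]
      have h2 : s' < t := by linarith [hs.2]
      have h3 : ContinuousWithinAt (Γ s') (Icc 0 s') s := hΓ s' h2 s ⟨hs.1, h1.le⟩
      have h4 : ContinuousWithinAt (fun s => Γ s s) (Icc 0 s') s :=
        h3.congr (fun x hx => hag x s' hx.1 hx.2 h2) (hag s s' hs.1 h1.le h2)
      refine h4.mono_of_mem_nhdsWithin ?_
      filter_upwards [self_mem_nhdsWithin, mem_nhdsWithin_of_mem_nhds (Iio_mem_nhds h1)]
        with x hx hx'
      exact ⟨hx.1, le_of_lt hx'⟩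
    have hl : ∀ s ∈ Ico 0 t, Γ s s ∈ O ∧ f (Γ s s) = γ s := fun s hs =>
      hΓl s hs.2 s (right_mem_Icc.2 hs.1)
    have htI : t ∈ Icc (0 : ℝ) 1 := ⟨ht.1.le, ht.2⟩
    have hγt : Tendsto γ (𝓝[<] t) (𝓝 (γ t)) := by
      have h1 : Tendsto γ (𝓝[Icc 0 1] t) (𝓝 (γ t)) := hγ t htI
      refine h1.mono_left ?_
      rw [nhdsWithin_le_iff]
      filter_upwards [self_mem_nhdsWithin, mem_nhdsWithin_of_mem_nhds (Ioi_mem_nhds ht.1)]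
        with x hx hx'
      exact ⟨le_of_lt hx', (le_of_lt hx).trans ht.2⟩
    obtain ⟨ℓ, hℓ, hℓp, hℓf⟩ := exists_tendsto_of_lift hf hr ht.1 hcont hγt
      (fun s hs => ⟨(hl s hs).1.1, (hl s hs).2⟩) (fun h => hγP htI (hs _ (Or.inr h)))
    have hℓO : ℓ ∈ O := ⟨hℓp, by rw [hℓf]; exact hγP htI⟩
    refine ⟨Function.update (fun s => Γ s s) t ℓ, ?_, ?_, ?_⟩
    · rw [continuousOn_update_iff]
      have h5 : Icc 0 t \ {t} = Ico 0 t := Icc_sdiff_right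
      rw [h5]
      exact ⟨hcont, fun _ => hℓ.mono_left (nhdsWithin_mono _ fun x hx => hx.2)⟩
    · rw [Function.update_of_ne ht.1.ne]
      exact hΓ0 0 ht.1
    · intro s hs
      rcases hs.2.eq_or_lt with rfl | hst
      · rw [Function.update_self]; exact ⟨hℓO, hℓf⟩
      · rw [Function.update_of_ne hst.ne]; exact hl s ⟨hs.1, hst⟩
  have hextend : ∀ t ∈ T ∩ Ico 0 1, ∀ y ∈ Ioi t, (T ∩ Ioc t y).Nonempty := by
    rintro t ⟨⟨Γ, hΓ, hΓ0, hΓl⟩, ht⟩ y hy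
    have htl := hΓl t (right_mem_Icc.2 ht.1)
    have hs := ((hOa _ htl.1).hasStrictDerivAt).hasStrictFDerivAt_equiv (hOd _ htl.1)
    set e := hs.toOpenPartialHomeomorph f with he
    have hmem : Γ t ∈ e.source := hs.mem_toOpenPartialHomeomorph_source
    have hef : ∀ x, e x = f x := fun x => rfl
    have hγt : ContinuousWithinAt γ (Ici t) t := by
      refine (hγ t ⟨ht.1, ht.2.le⟩).mono_of_mem_nhdsWithin ?_
      filter_upwards [self_mem_nhdsWithin, mem_nhdsWithin_of_mem_nhds (Iio_mem_nhds ht.2)]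
        with x hx hx'
      exact ⟨ht.1.trans hx, le_of_lt hx'⟩
    have hγe : γ t ∈ e.target := by
      have := e.map_source hmem
      rwa [hef, htl.2] at this
    have hsymm : e.symm (γ t) = Γ t := by
      rw [← htl.2, ← hef, e.left_inv hmem]
    have hW : IsOpen (e.target ∩ e.symm ⁻¹' O) := e.isOpen_inter_preimage_symm hOo
    have hev : ∀ᶠ s in 𝓝[≥] t, γ s ∈ e.target ∩ e.symm ⁻¹' O :=
      hγt.eventually (hW.mem_nhds ⟨hγe, by change e.symm (γ t) ∈ O; rw [hsymm]; exact htl.1⟩)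
    obtain ⟨b, hbt, hb⟩ := mem_nhdsGE_iff_exists_Icc_subset.1 hev
    set c := min b (min y 1) with hc
    have htc : t < c := lt_min hbt (lt_min hy ht.2)
    have hcI : ∀ s ∈ Icc t c, γ s ∈ e.target ∩ e.symm ⁻¹' O := fun s hs =>
      hb ⟨hs.1, hs.2.trans (min_le_left _ _)⟩
    refine ⟨c, ⟨fun s => if s ≤ t then Γ s else e.symm (γ s), ?_, ?_, ?_⟩, htc,
      (min_le_right _ _).trans (min_le_left _ _)⟩
    · have hsub : Icc t c ⊆ Icc 0 1 :=
        Icc_subset_Icc ht.1 ((min_le_right _ _).trans (min_le_right _ _))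
      have h2 : ContinuousOn (fun s => e.symm (γ s)) (Icc t c) :=
        e.continuousOn_symm.comp (hγ.mono hsub) fun s hs => (hcI s hs).1
      refine ContinuousOn.if (fun s hs => ?_) ?_ ?_
      · have : s = t := by
          have := frontier_le_subset_eq continuous_id continuous_const hs.2
          exact this
        rw [this, hsymm]
      · refine hΓ.mono fun s hs => ⟨hs.1.1, ?_⟩
        have h3 := hs.2
        exact (closure_le_eq continuous_id continuous_const).subset h3
      · refine h2.mono fun s hs => ⟨?_, hs.1.2⟩
        have h3 := hs.2
        simp only [not_le] at h3
        exact closure_lt_subset_le continuous_const continuous_id h3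
    · simp only [if_pos ht.1]; exact hΓ0
    · intro s hs
      by_cases hst : s ≤ t
      · simp only [if_pos hst]; exact hΓl s ⟨hs.1, hst⟩
      · simp only [if_neg hst]
        have h3 := hcI s ⟨(not_le.1 hst).le, hs.2⟩
        exact ⟨h3.2, e.right_inv h3.1⟩
  have hclosed : IsClosed (T ∩ Icc 0 1) := by
    refine isClosed_of_closure_subset fun t ht => ?_
    have htI : t ∈ Icc (0 : ℝ) 1 := isClosed_Icc.closure_subset
      (closure_mono inter_subset_right ht)
    refine ⟨?_, htI⟩
    rcases htI.1.eq_or_lt with rfl | h0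
    · exact h0T
    refine hlimit t ⟨h0, htI.2⟩ fun s hs => ?_
    obtain ⟨t', ht', ht'T⟩ := mem_closure_iff.1 ht _ isOpen_Ioi hs
    exact hdown s t' (le_of_lt ht') ht'T.1
  have h1T : (1 : ℝ) ∈ T := hclosed.Icc_subset_of_forall_exists_gt h0T hextend
    (right_mem_Icc.2 zero_le_one)
  exact h1T

end Lifting

/-- The points whose first `n` iterates are defined, with the `n`-th one outside `P`, for a set `P`
with `f(P) ⊆ P`. -/
def iterDomain (f : ℂ → ℂ) (P : Set ℂ) : ℕ → Set ℂ
  | 0 => Pᶜ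
  | n + 1 => {z | ¬ IsPole f z ∧ f z ∉ P} ∩ f ⁻¹' iterDomain f P n

/-- `P` is a closed forward invariant set that contains the finite singular values and the disc of
radius `r` about the attracting fixed point `ξ`, and `H` is a homeomorphism that is the identity
near `∞`, moves `P` into the disc of radius `2 * r` and whose inverse moves the disc of radius
`3 * r` into the basin. Poles have multiplicity at most `M`. -/
structure PostsingularSetup (f : ℂ → ℂ) (ξ : ℂ) (r : ℝ) (P : Set ℂ) (H : ℂ ≃ₜ ℂ) (L : ℝ) (M : ℕ) :
    Prop where
  nf : MeromorphicNFOn f univ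
  not_isRational : ¬ IsRational f
  not_isAsymptoticValue : ¬ IsAsymptoticValue f OnePoint.infty
  le_order : ∀ z, IsPole f z → ((-(M : ℤ) : ℤ) : WithTop ℤ) ≤ meromorphicOrderAt f z
  r_pos : 0 < r
  isClosed : IsClosed P
  closedBall_subset : Metric.closedBall ξ r ⊆ P
  not_isPole : ∀ z ∈ P, ¬ IsPole f z
  mapsTo : MapsTo f P P
  mem_of_singInv : ∀ a : ℂ, (a : OnePoint ℂ) ∈ singInv f → a ∈ P
  dist_le : ∀ z ∈ P, dist (H z) ξ ≤ 2 * r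
  log_le : Real.log (3 * r) ≤ L
  eq_self : ∀ z, Real.exp L ≤ dist z ξ → H z = z
  mem_basin : ∀ z, dist (H z) ξ ≤ 3 * r → z ∈ basin f ξ
  isOpen_basin : IsOpen (basin f ξ)

/-- The exponential parametrization of the complement of `H⁻¹(ξ)`. -/
noncomputable def expParam (ξ : ℂ) (H : ℂ ≃ₜ ℂ) (ζ : ℂ) : ℂ := H.symm (ξ + Complex.exp ζ)

/-- The half-plane on which `expParam` is considered. -/
def paramDomain (r : ℝ) : Set ℂ := {ζ | Real.log (2 * r) < ζ.re}

/-- `Φ` is a lift of `expParam` through `f^[n]`. -/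
structure IsParamLift (f : ℂ → ℂ) (ξ : ℂ) (r : ℝ) (P : Set ℂ) (H : ℂ ≃ₜ ℂ) (n : ℕ) (Φ : ℂ → ℂ) :
    Prop where
  continuousOn : ContinuousOn Φ (paramDomain r)
  mem : ∀ ζ ∈ paramDomain r, Φ ζ ∈ iterDomain f P n
  eq : ∀ ζ ∈ paramDomain r, f^[n] (Φ ζ) = expParam ξ H ζ

theorem isOpen_paramDomain (r : ℝ) : IsOpen (paramDomain r) :=
  isOpen_lt continuous_const Complex.continuous_re

theorem convex_paramDomain (r : ℝ) : Convex ℝ (paramDomain r) := convex_halfSpace_re_gt _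

theorem add_mem_paramDomain {r : ℝ} {ζ : ℂ} (hζ : ζ ∈ paramDomain r) (k : ℕ) :
    ζ + k * (2 * Real.pi * Complex.I) ∈ paramDomain r := by
  change Real.log (2 * r) < _
  simpa using! hζ

theorem continuous_expParam (ξ : ℂ) (H : ℂ ≃ₜ ℂ) : Continuous (expParam ξ H) :=
  H.symm.continuous.comp (continuous_const.add Complex.continuous_exp)

theorem isOpenMap_expParam (ξ : ℂ) (H : ℂ ≃ₜ ℂ) : IsOpenMap (expParam ξ H) := by
  have h1 : IsOpenMap Complex.exp := isOpenMap_of_hasStrictDerivAt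
    (fun z => Complex.hasStrictDerivAt_exp z) fun z => Complex.exp_ne_zero z
  exact H.symm.isOpenMap.comp ((isOpenMap_add_left ξ).comp h1)

theorem expParam_add (ξ : ℂ) (H : ℂ ≃ₜ ℂ) (ζ : ℂ) (k : ℕ) :
    expParam ξ H (ζ + k * (2 * Real.pi * Complex.I)) = expParam ξ H ζ := by
  unfold expParam
  rw [Complex.exp_add, Complex.exp_nat_mul_two_pi_mul_I, mul_one]

theorem exists_add_of_expParam_eq {ξ : ℂ} {H : ℂ ≃ₜ ℂ} {ζ ζ' : ℂ}
    (h : expParam ξ H ζ = expParam ξ H ζ') :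
    ∃ k : ℕ, ζ = ζ' + k * (2 * Real.pi * Complex.I) ∨
      ζ' = ζ + k * (2 * Real.pi * Complex.I) := by
  have h1 : Complex.exp ζ = Complex.exp ζ' := add_left_cancel (H.symm.injective h)
  obtain ⟨n, hn⟩ := Complex.exp_eq_exp_iff_exists_int.1 h1
  refine ⟨n.natAbs, ?_⟩
  rcases n.natAbs_eq with h2 | h2
  · left
    rw [hn, h2]; simp
  · right
    rw [hn, h2]; simp

theorem apply_expParam (ξ : ℂ) (H : ℂ ≃ₜ ℂ) (ζ : ℂ) :
    H (expParam ξ H ζ) = ξ + Complex.exp ζ := H.apply_symm_apply _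

theorem dist_apply_expParam (ξ : ℂ) (H : ℂ ≃ₜ ℂ) (ζ : ℂ) :
    dist (H (expParam ξ H ζ)) ξ = Real.exp ζ.re := by
  rw [apply_expParam, dist_self_add_left, Complex.norm_exp]

theorem exists_expParam_eq {ξ : ℂ} {H : ℂ ≃ₜ ℂ} {z : ℂ} (hz : H z ≠ ξ) :
    ∃ ζ, expParam ξ H ζ = z ∧ ζ.re = Real.log (dist (H z) ξ) := by
  refine ⟨Complex.log (H z - ξ), ?_, ?_⟩
  · unfold expParam
    rw [Complex.exp_log (sub_ne_zero.2 hz), add_sub_cancel, H.symm_apply_apply]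
  · rw [Complex.log_re, dist_eq_norm]

namespace PostsingularSetup

variable {f : ℂ → ℂ} {ξ : ℂ} {r : ℝ} {P : Set ℂ} {H : ℂ ≃ₜ ℂ} {L : ℝ} {M : ℕ}

theorem iterate_mem (hS : PostsingularSetup f ξ r P H L M) {z : ℂ} (hz : z ∈ P) (n : ℕ) :
    f^[n] z ∈ P := hS.mapsTo.iterate n hz

theorem mem_iterDomain_iff (hS : PostsingularSetup f ξ r P H L M) {n : ℕ} {z : ℂ} :
    z ∈ iterDomain f P n ↔ (∀ k < n, ¬ IsPole f (f^[k] z)) ∧ f^[n] z ∉ P := by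
  induction n generalizing z with
  | zero => simp [iterDomain]
  | succ n ih =>
    constructor
    · rintro ⟨⟨h1, -⟩, h3⟩
      obtain ⟨h4, h5⟩ := ih.1 h3
      refine ⟨fun k hk => ?_, h5⟩
      rcases k with _ | k
      · exact h1
      · exact h4 k (by omega)
    · rintro ⟨h1, h2⟩
      exact ⟨⟨h1 0 (by omega), fun h => h2 (hS.iterate_mem h n)⟩,
        ih.2 ⟨fun k hk => h1 (k + 1) (by omega), h2⟩⟩

theorem iterDomain_subset_compl (hS : PostsingularSetup f ξ r P H L M) (n : ℕ) :
    iterDomain f P n ⊆ Pᶜ := fun _ hz hzP => (hS.mem_iterDomain_iff.1 hz).2 (hS.iterate_mem hzP n)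

theorem iterDomain_antitone (hS : PostsingularSetup f ξ r P H L M) {m n : ℕ} (hmn : m ≤ n) :
    iterDomain f P n ⊆ iterDomain f P m := fun z hz => by
  obtain ⟨h1, h2⟩ := hS.mem_iterDomain_iff.1 hz
  refine hS.mem_iterDomain_iff.2 ⟨fun k hk => h1 k (by omega), fun h => h2 ?_⟩
  have := hS.iterate_mem h (n - m)
  rwa [← Function.iterate_add_apply, Nat.sub_add_cancel hmn] at this

theorem isConformalCovering (hS : PostsingularSetup f ξ r P H L M) (n : ℕ) :
    IsConformalCovering f^[n] (iterDomain f P n) Pᶜ := by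
  induction n with
  | zero => exact IsConformalCovering.id_of_isOpen hS.isClosed.isOpen_compl
  | succ n ih =>
    exact ih.comp (isConformalCovering_of_singInv hS.nf hS.not_isRational hS.isClosed
      hS.mem_of_singInv) (hS.iterDomain_subset_compl n)

theorem mapsTo_expParam (hS : PostsingularSetup f ξ r P H L M) :
    MapsTo (expParam ξ H) (paramDomain r) Pᶜ := fun ζ hζ hP => by
  have h1 := hS.dist_le _ hP
  rw [dist_apply_expParam] at h1
  have h2 : Real.log (2 * r) < ζ.re := hζ
  rw [Real.log_lt_iff_lt_exp (by linarith [hS.r_pos])] at h2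
  linarith

theorem expParam_eq (hS : PostsingularSetup f ξ r P H L M) {ζ : ℂ} (hζ : L ≤ ζ.re) :
    expParam ξ H ζ = ξ + Complex.exp ζ := by
  unfold expParam
  rw [Homeomorph.symm_apply_eq, hS.eq_self]
  rw [dist_self_add_left, Complex.norm_exp]
  exact Real.exp_le_exp.2 hζ

theorem log_lt (hS : PostsingularSetup f ξ r P H L M) :
    Real.log (2 * r) < Real.log (3 * r) := by
  have := hS.r_pos
  exact Real.log_lt_log (by linarith) (by linarith)

theorem mem_paramDomain (hS : PostsingularSetup f ξ r P H L M) {ζ : ℂ}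
    (hζ : Real.log (3 * r) ≤ ζ.re) : ζ ∈ paramDomain r := hS.log_lt.trans_le hζ

/-- Points outside the basin lie in the image of a smaller half-plane. -/
theorem exists_expParam_eq_of_notMem_basin (hS : PostsingularSetup f ξ r P H L M) {z : ℂ}
    (hz : z ∉ basin f ξ) : ∃ ζ, expParam ξ H ζ = z ∧ Real.log (3 * r) ≤ ζ.re := by
  have h1 : 3 * r < dist (H z) ξ := not_le.1 fun h => hz (hS.mem_basin z h)
  have hr := hS.r_pos
  have h2 : H z ≠ ξ := fun h => by rw [h, dist_self] at h1; linarith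
  obtain ⟨ζ, h3, h4⟩ := exists_expParam_eq h2
  exact ⟨ζ, h3, by rw [h4]; exact Real.log_le_log (by linarith) h1.le⟩

theorem le_re_of_notMem_basin (hS : PostsingularSetup f ξ r P H L M) {ζ : ℂ}
    (hz : expParam ξ H ζ ∉ basin f ξ) : Real.log (3 * r) ≤ ζ.re := by
  have h1 : 3 * r < dist (H (expParam ξ H ζ)) ξ := not_le.1 fun h => hz (hS.mem_basin _ h)
  rw [dist_apply_expParam] at h1
  have hr := hS.r_pos
  exact ((Real.log_lt_iff_lt_exp (by linarith)).2 h1).le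

theorem exists_lift (hS : PostsingularSetup f ξ r P H L M) {n : ℕ} {z ζ : ℂ}
    (hz : z ∈ iterDomain f P n) (hζ : ζ ∈ paramDomain r) (h : f^[n] z = expParam ξ H ζ) :
    ∃ Φ, IsParamLift f ξ r P H n Φ ∧ Φ ζ = z := by
  obtain ⟨Φ, h1, h2, h3⟩ := (hS.isConformalCovering n).exists_lift_of_convex (convex_paramDomain r)
    (continuous_expParam ξ H).continuousOn hS.mapsTo_expParam hζ hz h
  exact ⟨Φ, ⟨h1, fun ζ hζ => (h3 ζ hζ).1, fun ζ hζ => (h3 ζ hζ).2⟩, h2⟩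

theorem lift_eqOn (hS : PostsingularSetup f ξ r P H L M) {n : ℕ} {Φ Ψ : ℂ → ℂ}
    (hΦ : IsParamLift f ξ r P H n Φ) (hΨ : IsParamLift f ξ r P H n Ψ) {ζ : ℂ}
    (hζ : ζ ∈ paramDomain r) (h : Φ ζ = Ψ ζ) : EqOn Φ Ψ (paramDomain r) :=
  (hS.isConformalCovering n).eqOn_of_lifts (convex_paramDomain r).isPreconnected hΦ.continuousOn
    hΨ.continuousOn (fun a ha => ⟨hΦ.mem a ha, hΦ.eq a ha⟩)
    (fun a ha => ⟨hΨ.mem a ha, hΨ.eq a ha⟩) hζ h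

theorem lift_translate {n : ℕ} {Φ : ℂ → ℂ} (hΦ : IsParamLift f ξ r P H n Φ) (k : ℕ) :
    IsParamLift f ξ r P H n fun ζ => Φ (ζ + k * (2 * Real.pi * Complex.I)) where
  continuousOn := hΦ.continuousOn.comp (by fun_prop) fun ζ hζ => add_mem_paramDomain hζ k
  mem ζ hζ := hΦ.mem _ (add_mem_paramDomain hζ k)
  eq ζ hζ := by rw [hΦ.eq _ (add_mem_paramDomain hζ k), expParam_add]

theorem isOpen_image_lift (hS : PostsingularSetup f ξ r P H L M) {n : ℕ} {Φ : ℂ → ℂ}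
    (hΦ : IsParamLift f ξ r P H n Φ) : IsOpen (Φ '' paramDomain r) :=
  (hS.isConformalCovering n).isOpen_image_lift (isOpen_paramDomain r)
    (fun _ _ hB => isOpenMap_expParam ξ H _ hB) hΦ.continuousOn
    fun a ha => ⟨hΦ.mem a ha, hΦ.eq a ha⟩

/-- The images of two lifts coincide or are disjoint. -/
theorem image_lift_subset (hS : PostsingularSetup f ξ r P H L M) {n : ℕ} {Φ Ψ : ℂ → ℂ}
    (hΦ : IsParamLift f ξ r P H n Φ) (hΨ : IsParamLift f ξ r P H n Ψ)
    (h : (Φ '' paramDomain r ∩ Ψ '' paramDomain r).Nonempty) :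
    Φ '' paramDomain r ⊆ Ψ '' paramDomain r := by
  obtain ⟨_, ⟨ζ, hζ, rfl⟩, ζ', hζ', heq⟩ := h
  have hE : expParam ξ H ζ = expParam ξ H ζ' := by
    rw [← hΦ.eq ζ hζ, ← hΨ.eq ζ' hζ', heq]
  obtain ⟨k, rfl | rfl⟩ := exists_add_of_expParam_eq hE
  · have h1 := hS.lift_eqOn hΨ (lift_translate hΦ k) hζ' heq
    rintro _ ⟨x, hx, rfl⟩
    have h2 : x - k * (2 * Real.pi * Complex.I) ∈ paramDomain r := by
      change Real.log (2 * r) < _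
      simpa using! hx
    refine ⟨_, h2, ?_⟩
    rw [h1 h2]
    simp
  · have h1 := hS.lift_eqOn hΦ (lift_translate hΨ k) hζ heq.symm
    rintro _ ⟨x, hx, rfl⟩
    exact ⟨_, add_mem_paramDomain hx k, (h1 hx).symm⟩

/-- A connected set over the image of the parametrization lies in the image of a single lift. -/
theorem subset_image_lift (hS : PostsingularSetup f ξ r P H L M) {n : ℕ} {Φ : ℂ → ℂ}
    (hΦ : IsParamLift f ξ r P H n Φ) {C : Set ℂ} (hC : IsPreconnected C)
    (hCn : C ⊆ iterDomain f P n) (hCE : ∀ z ∈ C, ∃ ζ ∈ paramDomain r, f^[n] z = expParam ξ H ζ)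
    (hne : (C ∩ Φ '' paramDomain r).Nonempty) : C ⊆ Φ '' paramDomain r := by
  refine hC.subset_of_closure_inter_subset (hS.isOpen_image_lift hΦ) hne ?_
  rintro z ⟨hz, hzC⟩
  obtain ⟨ζ, hζ, h⟩ := hCE z hzC
  obtain ⟨Ψ, hΨ, hΨz⟩ := hS.exists_lift (hCn hzC) hζ h
  have hzΨ : z ∈ Ψ '' paramDomain r := ⟨ζ, hζ, hΨz⟩
  have h1 := mem_closure_iff.1 hz _ (hS.isOpen_image_lift hΨ) hzΨ
  exact hS.image_lift_subset hΨ hΦ h1 hzΨ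

/-- The lift through `f` converges to a pole at the right end of the half-plane. -/
theorem exists_isPole_of_lift (hS : PostsingularSetup f ξ r P H L M) {Φ : ℂ → ℂ}
    (hΦ : IsParamLift f ξ r P H 1 Φ) :
    ∃ p, IsPole f p ∧ ∀ δ > 0, ∃ l : ℝ, ∀ ζ : ℂ, l < ζ.re → Φ ζ ∈ Metric.ball p δ := by
  have hpath : ∀ t ∈ Ici (0 : ℝ), ((L + t : ℝ) : ℂ) ∈ paramDomain r := fun t ht => by
    have h1 := hS.log_lt
    have h2 := hS.log_le
    have ht' : 0 ≤ t := ht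
    change Real.log (2 * r) < _
    rw [Complex.ofReal_re]
    linarith
  have hLr : Real.log (2 * r) < L := hS.log_lt.trans_le hS.log_le
  have hmem : ∀ ζ ∈ paramDomain r, ¬ IsPole f (Φ ζ) ∧ f (Φ ζ) = expParam ξ H ζ := fun ζ hζ =>
    ⟨(hΦ.mem ζ hζ).1.1, hΦ.eq ζ hζ⟩
  have hγ : ContinuousOn (fun t : ℝ => Φ ((L + t : ℝ) : ℂ)) (Ici 0) :=
    hΦ.continuousOn.comp (by fun_prop) hpath
  have hbig : ∀ K : ℝ, ∃ l : ℝ, L ≤ l ∧ ∀ ζ : ℂ, l < ζ.re → K < ‖expParam ξ H ζ‖ := fun K => by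
    have h1 : Tendsto Real.exp atTop atTop := Real.tendsto_exp_atTop
    obtain ⟨l, hl⟩ := eventually_atTop.1 (h1.eventually_gt_atTop (K + ‖ξ‖))
    refine ⟨max L l, le_max_left _ _, fun ζ hζ => ?_⟩
    rw [hS.expParam_eq ((le_max_left _ _).trans hζ.le)]
    have h2 := hl ζ.re ((le_max_right _ _).trans hζ.le)
    have h3 := norm_sub_le (ξ + Complex.exp ζ) ξ
    rw [add_sub_cancel_left, Complex.norm_exp] at h3
    linarith
  have hlim : Tendsto (fun t : ℝ => toSphere f (Φ ((L + t : ℝ) : ℂ))) atTop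
      (𝓝 OnePoint.infty) := by
    have h1 : Tendsto (fun t : ℝ => expParam ξ H ((L + t : ℝ) : ℂ)) atTop (cocompact ℂ) := by
      rw [← Metric.cobounded_eq_cocompact, ← tendsto_norm_atTop_iff_cobounded, tendsto_atTop]
      intro K
      obtain ⟨l, -, hl⟩ := hbig K
      filter_upwards [eventually_gt_atTop (l - L)] with t ht
      exact (hl _ (by rw [Complex.ofReal_re]; linarith)).le
    rw [← coclosedCompact_eq_cocompact] at h1
    refine (OnePoint.tendsto_coe_infty.comp h1).congr' ?_
    filter_upwards [eventually_ge_atTop 0] with t ht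
    have h2 := hmem _ (hpath t ht)
    rw [toSphere_of_not_isPole h2.1, h2.2]; rfl
  rcases tendsto_cocompact_or_exists_tendsto hS.nf hS.not_isRational hγ hlim with h | ⟨p, hp, hfp⟩
  · exact absurd ⟨_, hγ, h, hlim⟩ hS.not_isAsymptoticValue
  have hpole := toSphere_eq_infty_iff.1 hfp
  refine ⟨p, hpole, fun δ hδ => ?_⟩
  obtain ⟨δ₀, hδ₀, hiso⟩ := Metric.eventually_nhds_iff.1
    (eventually_nhdsWithin_iff.1 (eventually_not_isPole hS.nf p))
  set ε := min δ δ₀ / 2 with hε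
  have hm : 0 < min δ δ₀ := lt_min hδ hδ₀
  have hε0 : 0 < ε := by positivity
  have hεlt : ε < min δ δ₀ := by linarith
  have hcont : ContinuousOn f (Metric.sphere p ε) := fun z hz => by
    have hz' : dist z p = ε := hz
    have hz'' : dist z p < δ₀ := hz' ▸ hεlt.trans_le (min_le_right _ _)
    refine (analyticAt_of_not_isPole hS.nf (hiso hz'' ?_)).continuousAt.continuousWithinAt
    intro h
    rw [mem_singleton_iff.1 h, dist_self] at hz'
    exact hε0.ne hz'
  obtain ⟨K, hK⟩ := ((isCompact_sphere p ε).image_of_continuousOn hcont).isBounded.exists_norm_le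
  obtain ⟨l, hLl, hl⟩ := hbig K
  refine ⟨l, fun ζ hζ => ?_⟩
  have hsub : {ζ : ℂ | l < ζ.re} ⊆ paramDomain r := fun x hx => (hLr.trans_le hLl).trans hx
  obtain ⟨t, ht, htp⟩ := ((eventually_gt_atTop (l - L)).and
    (hp.eventually (Metric.ball_mem_nhds p hε0))).exists
  by_contra hcon
  have h1 : ε ≤ dist (Φ ζ) p :=
    (hεlt.le.trans (min_le_left _ _)).trans (not_lt.1 hcon)
  have htl : ((L + t : ℝ) : ℂ) ∈ {ζ : ℂ | l < ζ.re} := by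
    change l < _
    rw [Complex.ofReal_re]; linarith
  obtain ⟨s, hs, hsε⟩ := (convex_halfSpace_re_gt l).isPreconnected.intermediate_value
    (f := fun x => dist (Φ x) p) htl hζ
    ((continuous_id.dist (continuous_const (y := p))).comp_continuousOn
      (hΦ.continuousOn.mono hsub)) ⟨le_of_lt htp, h1⟩
  have h2 := hl s hs
  rw [← (hmem s (hsub hs)).2] at h2
  exact (hK _ ⟨Φ s, hsε, rfl⟩).not_gt h2

theorem exists_period_of_lift_one (hS : PostsingularSetup f ξ r P H L M) {Φ : ℂ → ℂ}
    (hΦ : IsParamLift f ξ r P H 1 Φ) :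
    ∃ j : ℕ, 0 < j ∧ j ≤ M ∧
      ∀ ζ ∈ paramDomain r, Φ (ζ + j * (2 * Real.pi * Complex.I)) = Φ ζ := by
  obtain ⟨p, hp, hlim⟩ := hS.exists_isPole_of_lift hΦ
  obtain ⟨V, hV, hcard⟩ := exists_nhds_card_le_of_isPole hS.nf hp (hS.le_order p hp)
  obtain ⟨δ, hδ, hδV⟩ := Metric.mem_nhds_iff.1 hV
  obtain ⟨l, hl⟩ := hlim δ hδ
  set ζ : ℂ := ((max L l + 1 : ℝ) : ℂ) with hζdef
  have hζre : ζ.re = max L l + 1 := Complex.ofReal_re _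
  have hζ : ζ ∈ paramDomain r := hS.mem_paramDomain (by
    rw [hζre]; linarith [le_max_left L l, hS.log_le])
  have hre : ∀ k : ℕ, (ζ + k * (2 * Real.pi * Complex.I)).re = ζ.re := fun k => by simp
  have hnot : ¬ InjOn (fun k : ℕ => Φ (ζ + k * (2 * Real.pi * Complex.I)))
      (Finset.range (M + 1) : Set ℕ) := fun hinj => by
    have h1 := hcard (expParam ξ H ζ)
      ((Finset.range (M + 1)).image fun k : ℕ => Φ (ζ + k * (2 * Real.pi * Complex.I)))
      (fun z hz => by
        obtain ⟨k, -, rfl⟩ := Finset.mem_image.1 hz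
        have h2 := add_mem_paramDomain hζ k
        refine ⟨hδV (hl _ ?_), (hΦ.mem _ h2).1.1, ?_⟩
        · rw [hre, hζre]; linarith [le_max_right L l]
        · exact (hΦ.eq _ h2).trans (expParam_add ξ H ζ k))
    rw [Finset.card_image_of_injOn hinj, Finset.card_range] at h1
    omega
  have key : ∀ k l : ℕ, k < l → l ≤ M → Φ (ζ + k * (2 * Real.pi * Complex.I)) =
      Φ (ζ + l * (2 * Real.pi * Complex.I)) → ∃ j : ℕ, 0 < j ∧ j ≤ M ∧
      ∀ ζ ∈ paramDomain r, Φ (ζ + j * (2 * Real.pi * Complex.I)) = Φ ζ := by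
    intro k l hkl hlM h
    refine ⟨l - k, by omega, by omega, fun x hx => ?_⟩
    refine (hS.lift_eqOn hΦ (lift_translate hΦ (l - k)) (add_mem_paramDomain hζ k) ?_ hx).symm
    rw [h]
    congr 1
    rw [Nat.cast_sub hkl.le]
    ring
  simp only [InjOn, not_forall] at hnot
  obtain ⟨k, hk, l, hl, heq, hne⟩ := hnot
  rw [Finset.coe_range, mem_Iio] at hk hl
  rcases lt_or_gt_of_ne hne with h | h
  · exact key k l h (by omega) heq
  · exact key l k h (by omega) heq.symm

theorem lift_comp_iterate (hS : PostsingularSetup f ξ r P H L M) {n : ℕ} {Φ : ℂ → ℂ}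
    (hΦ : IsParamLift f ξ r P H (n + 1) Φ) : IsParamLift f ξ r P H 1 (f^[n] ∘ Φ) where
  continuousOn := by
    have h1 : ContinuousOn f^[n] (iterDomain f P n) := fun z hz =>
      ((hS.isConformalCovering n).analyticAt z hz).continuousAt.continuousWithinAt
    exact h1.comp hΦ.continuousOn fun ζ hζ => hS.iterDomain_antitone (Nat.le_succ n) (hΦ.mem ζ hζ)
  mem ζ hζ := by
    obtain ⟨h1, h2⟩ := hS.mem_iterDomain_iff.1 (hΦ.mem ζ hζ)
    refine hS.mem_iterDomain_iff.2 ⟨fun k hk => ?_, ?_⟩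
    · obtain rfl : k = 0 := by omega
      exact h1 n (Nat.lt_succ_self n)
    · rw [Function.iterate_succ_apply'] at h2
      exact h2
  eq ζ hζ := by
    rw [← hΦ.eq ζ hζ, Function.iterate_succ_apply' f n]
    rfl

/-- All lifts through iterates of `f` have a common period. -/
theorem lift_periodic (hS : PostsingularSetup f ξ r P H L M) {n : ℕ} {Φ : ℂ → ℂ}
    (hΦ : IsParamLift f ξ r P H (n + 1) Φ) {ζ : ℂ} (hζ : ζ ∈ paramDomain r) (k : ℕ) :
    Φ (ζ + (k * M.factorial : ℕ) * (2 * Real.pi * Complex.I)) = Φ ζ := by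
  have hΨ := hS.lift_comp_iterate hΦ
  obtain ⟨j, hj0, hjM, hper⟩ := hS.exists_period_of_lift_one hΨ
  obtain ⟨p, hp, hlim⟩ := hS.exists_isPole_of_lift hΨ
  have hpP : p ∈ Pᶜ := fun h => hS.not_isPole p h hp
  obtain ⟨δ, hδ, hδP⟩ := Metric.isOpen_iff.1 hS.isClosed.isOpen_compl p hpP
  obtain ⟨l, hl⟩ := hlim δ hδ
  set A : Set ℂ := {x | max l (Real.log (2 * r)) < x.re} with hA
  have hAc : Convex ℝ A := convex_halfSpace_re_gt _
  have hAl : ∀ x ∈ A, l < x.re := fun x hx => (le_max_left _ _).trans_lt hx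
  have hAp : A ⊆ paramDomain r := fun x hx =>
    lt_of_le_of_lt (le_max_right l (Real.log (2 * r))) hx
  set x : ℂ := ((max l (Real.log (2 * r)) + 1 : ℝ) : ℂ) with hx
  have hxA : x ∈ A := by
    change _ < x.re
    rw [hx, Complex.ofReal_re]; linarith
  have hxA' : x + j * (2 * Real.pi * Complex.I) ∈ A := by
    have hre : (x + j * (2 * Real.pi * Complex.I)).re = x.re := by simp
    change max l (Real.log (2 * r)) < _
    rw [hre]; exact hxA
  have hmem : ∀ y ∈ A, Φ y ∈ iterDomain f P n := fun y hy =>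
    hS.iterDomain_antitone (Nat.le_succ n) (hΦ.mem y (hAp hy))
  obtain ⟨G, hG, hG0, hGl⟩ := (hS.isConformalCovering n).exists_lift_of_convex (convex_ball p δ)
    continuousOn_id hδP (hl x (hAl x hxA)) (hmem x hxA) rfl
  have heq : EqOn Φ (G ∘ (f^[n] ∘ Φ)) A := by
    refine (hS.isConformalCovering n).eqOn_of_lifts (E := f^[n] ∘ Φ) hAc.isPreconnected
      (hΦ.continuousOn.mono hAp)
      (hG.comp (hΨ.continuousOn.mono hAp) fun y hy => hl y (hAl y hy))
      (fun y hy => ⟨hmem y hy, rfl⟩) (fun y hy => hGl _ (hl y (hAl y hy))) hxA hG0.symm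
  have h1 : Φ (x + j * (2 * Real.pi * Complex.I)) = Φ x := by
    rw [heq hxA', heq hxA, Function.comp_apply, hper x (hAp hxA)]
    rfl
  have hstep : ∀ y ∈ paramDomain r, Φ (y + j * (2 * Real.pi * Complex.I)) = Φ y := fun y hy =>
    hS.lift_eqOn (lift_translate hΦ j) hΦ (hAp hxA) h1 hy
  have hmul : ∀ q : ℕ, Φ (ζ + (q * j : ℕ) * (2 * Real.pi * Complex.I)) = Φ ζ := by
    intro q
    induction q with
    | zero => simp
    | succ q ih =>
      rw [← ih, ← hstep _ (add_mem_paramDomain hζ (q * j))]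
      congr 1
      push_cast
      ring
  obtain ⟨q, hq⟩ := (Nat.dvd_factorial hj0 hjM)
  have := hmul (k * q)
  rwa [mul_assoc, mul_comm q j, ← hq] at this

end PostsingularSetup

/-- The norm of the derivative of `1 / (G - ξ)`, where `G` is the branch of the inverse of `f^[n]`
determined by the lift `Φ`. -/
noncomputable def inverseBranchDeriv (f : ℂ → ℂ) (ξ : ℂ) (n : ℕ) (Φ : ℂ → ℂ) (ζ : ℂ) : ℝ :=
  ‖((Φ ζ - ξ) ^ 2)⁻¹ * (deriv f^[n] (Φ ζ))⁻¹‖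

/-- A bounded holomorphic function with zero-free derivative has comparable derivatives near the
centre of a disc. -/
theorem norm_deriv_pow_three_le {k : ℂ → ℂ} {w : ℂ} {ρ m : ℝ} (hρ : 0 < ρ) (hm : 0 < m)
    (hk : DifferentiableOn ℂ k (Metric.ball w ρ)) (hkm : ∀ y ∈ Metric.ball w ρ, ‖k y‖ ≤ m)
    (hk0 : ∀ y ∈ Metric.ball w ρ, deriv k y ≠ 0) {y y' : ℂ} (hy : y ∈ Metric.ball w (ρ / 8))
    (hy' : y' ∈ Metric.ball w (ρ / 8)) :
    ‖deriv k y'‖ ^ 3 ≤ (8 * m / ρ) ^ 2 * ‖deriv k y‖ := by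
  rw [Metric.mem_ball] at hy hy'
  have hsub : Metric.ball y (ρ / 2) ⊆ Metric.ball w ρ :=
    Metric.ball_subset_ball' (by linarith)
  refine norm_pow_three_le_of_ne_zero (ρ := ρ / 2) (by linarith)
    ((hk.deriv Metric.isOpen_ball).mono hsub) (fun z hz => hk0 z (hsub hz)) (fun z hz => ?_) ?_
  · rw [Metric.mem_ball] at hz
    have hz' : Metric.closedBall z (ρ / 4) ⊆ Metric.ball w ρ := fun x hx => by
      rw [Metric.mem_closedBall] at hx
      rw [Metric.mem_ball]
      linarith [dist_triangle x z w, dist_triangle z y w]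
    have h1 := Complex.norm_deriv_le_of_forall_mem_sphere_norm_le (f := k) (c := z)
      (C := m) (show 0 < ρ / 4 by linarith)
      ((hk.mono hz').diffContOnCl_ball Subset.rfl)
      fun x hx => hkm x (hz' (Metric.sphere_subset_closedBall hx))
    refine h1.trans_lt ?_
    rw [div_lt_div_iff₀ (by linarith) hρ]
    nlinarith [mul_pos hm hρ]
  · linarith [dist_triangle_right y' y w]

theorem tendsto_zero_of_pow {ι : Type*} {l : Filter ι} {u : ι → ℝ} {k : ℕ}
    (hu : ∀ n, 0 ≤ u n) (h : Tendsto (fun n => u n ^ k) l (𝓝 0)) : Tendsto u l (𝓝 0) := by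
  rw [Metric.tendsto_nhds] at h ⊢
  intro ε hε
  filter_upwards [h (ε ^ k) (pow_pos hε k)] with n hn
  rw [dist_zero_right, Real.norm_of_nonneg (pow_nonneg (hu n) k)] at hn
  rw [dist_zero_right, Real.norm_of_nonneg (hu n)]
  exact lt_of_pow_lt_pow_left₀ k hε.le hn

namespace PostsingularSetup

variable {f : ℂ → ℂ} {ξ : ℂ} {r : ℝ} {P : Set ℂ} {H : ℂ ≃ₜ ℂ} {L : ℝ} {M : ℕ}

theorem lt_dist_of_mem_iterDomain (hS : PostsingularSetup f ξ r P H L M) {n : ℕ} {z : ℂ}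
    (hz : z ∈ iterDomain f P n) : r < ‖z - ξ‖ := by
  rw [← dist_eq_norm]
  by_contra h
  exact hS.iterDomain_subset_compl n hz (hS.closedBall_subset (not_lt.1 h))

theorem norm_inv_le (hS : PostsingularSetup f ξ r P H L M) {n : ℕ} {z : ℂ}
    (hz : z ∈ iterDomain f P n) : ‖(z - ξ)⁻¹‖ ≤ 1 / r := by
  rw [norm_inv, ← one_div]
  exact one_div_le_one_div_of_le hS.r_pos (hS.lt_dist_of_mem_iterDomain hz).le

/-- Locally, a lift factors through the parametrization and a holomorphic inverse branch. -/
theorem exists_local_factor (hS : PostsingularSetup f ξ r P H L M) {n : ℕ} {Φ : ℂ → ℂ}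
    (hΦ : IsParamLift f ξ r P H n Φ) {ζ₀ : ℂ} (hζ₀ : ζ₀ ∈ paramDomain r) {ρ : ℝ} (hρ : 0 < ρ)
    (hball : Metric.ball (expParam ξ H ζ₀) ρ ⊆ Pᶜ) :
    ∃ k : ℂ → ℂ, DifferentiableOn ℂ k (Metric.ball (expParam ξ H ζ₀) ρ) ∧
      (∀ y ∈ Metric.ball (expParam ξ H ζ₀) ρ, ‖k y‖ ≤ 1 / r ∧ deriv k y ≠ 0 ∧
        ∃ x ∈ iterDomain f P n, f^[n] x = y ∧ k y = (x - ξ)⁻¹) ∧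
      ∀ N ⊆ paramDomain r, IsPreconnected N → ζ₀ ∈ N →
        MapsTo (expParam ξ H) N (Metric.ball (expParam ξ H ζ₀) ρ) →
        ∀ ζ ∈ N, (Φ ζ - ξ)⁻¹ = k (expParam ξ H ζ) ∧
          inverseBranchDeriv f ξ n Φ ζ = ‖deriv k (expParam ξ H ζ)‖ := by
  have hc := hS.isConformalCovering n
  obtain ⟨G, hG0, hGl, hGd⟩ := hc.exists_inverse_branch hρ (hΦ.mem ζ₀ hζ₀)
    (by rw [hΦ.eq ζ₀ hζ₀]; exact hball)
  rw [hΦ.eq ζ₀ hζ₀] at hG0 hGl hGd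
  have hne : ∀ y ∈ Metric.ball (expParam ξ H ζ₀) ρ, G y - ξ ≠ 0 := fun y hy => norm_pos_iff.1
    (hS.r_pos.trans (hS.lt_dist_of_mem_iterDomain (hGl y hy).1))
  have hkd : ∀ y ∈ Metric.ball (expParam ξ H ζ₀) ρ, HasDerivAt (fun y => (G y - ξ)⁻¹)
      (-(deriv f^[n] (G y))⁻¹ / (G y - ξ) ^ 2) y := fun y hy =>
    ((hGd y hy).sub_const ξ).fun_inv (hne y hy)
  refine ⟨fun y => (G y - ξ)⁻¹, fun y hy => (hkd y hy).differentiableAt.differentiableWithinAt,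
    fun y hy => ⟨hS.norm_inv_le (hGl y hy).1, ?_, G y, (hGl y hy).1, (hGl y hy).2, rfl⟩,
    fun N hN hNc hζ₀N hNE ζ hζ => ?_⟩
  · rw [(hkd y hy).deriv]
    exact div_ne_zero (neg_ne_zero.2 (inv_ne_zero (hc.deriv_ne_zero _ (hGl y hy).1)))
      (pow_ne_zero _ (hne y hy))
  · have hGc : ContinuousOn G (Metric.ball (expParam ξ H ζ₀) ρ) := fun y hy =>
      (hGd y hy).continuousAt.continuousWithinAt
    have heq : EqOn Φ (G ∘ expParam ξ H) N :=
      hc.eqOn_of_lifts hNc (hΦ.continuousOn.mono hN)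
        (hGc.comp (continuous_expParam ξ H).continuousOn hNE)
        (fun a ha => ⟨hΦ.mem a (hN ha), hΦ.eq a (hN ha)⟩) (fun a ha => hGl _ (hNE ha)) hζ₀N hG0.symm
    have h1 : Φ ζ = G (expParam ξ H ζ) := heq hζ
    refine ⟨by rw [h1], ?_⟩
    rw [(hkd _ (hNE hζ)).deriv, inverseBranchDeriv, h1, neg_div, norm_neg, div_eq_inv_mul]

theorem exists_ball_mapsTo (ξ : ℂ) (H : ℂ ≃ₜ ℂ) {ζ₀ : ℂ} (hζ₀ : ζ₀ ∈ paramDomain r) {ρ : ℝ}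
    (hρ : 0 < ρ) :
    ∃ η > 0, Metric.ball ζ₀ η ⊆ paramDomain r ∧
      MapsTo (expParam ξ H) (Metric.ball ζ₀ η) (Metric.ball (expParam ξ H ζ₀) ρ) := by
  have h1 := (isOpen_paramDomain r).mem_nhds hζ₀
  have h2 := (continuous_expParam ξ H).continuousAt.preimage_mem_nhds
    (Metric.ball_mem_nhds (expParam ξ H ζ₀) hρ)
  obtain ⟨η, hη, h⟩ := Metric.mem_nhds_iff.1 (inter_mem h1 h2)
  exact ⟨η, hη, fun x hx => (h hx).1, fun x hx => (h hx).2⟩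

/-- Near each point, the derivatives of the inverse branches are comparable and control the
oscillation of the lifts, uniformly over all lifts. -/
theorem exists_local_bounds (hS : PostsingularSetup f ξ r P H L M) {ζ₀ : ℂ}
    (hζ₀ : ζ₀ ∈ paramDomain r) :
    ∃ η > 0, ∃ C : ℝ, Metric.ball ζ₀ η ⊆ paramDomain r ∧
      ∀ (n : ℕ) (Φ : ℂ → ℂ), IsParamLift f ξ r P H n Φ →
        (∀ ζ ∈ Metric.ball ζ₀ η, ∀ ζ' ∈ Metric.ball ζ₀ η,
          inverseBranchDeriv f ξ n Φ ζ' ^ 3 ≤ C * inverseBranchDeriv f ξ n Φ ζ) ∧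
        ∀ ζ ∈ Metric.ball ζ₀ η,
          ‖(Φ ζ - ξ)⁻¹ - (Φ ζ₀ - ξ)⁻¹‖ ^ 3 ≤ C * inverseBranchDeriv f ξ n Φ ζ₀ := by
  have hr : 0 < 1 / r := one_div_pos.2 hS.r_pos
  obtain ⟨ρ, hρ, hball⟩ := Metric.isOpen_iff.1 hS.isClosed.isOpen_compl _ (hS.mapsTo_expParam hζ₀)
  obtain ⟨η, hη, hηp, hηE⟩ := exists_ball_mapsTo ξ H hζ₀ (show 0 < ρ / 8 by linarith)
  set B := (8 * (1 / r) / ρ) ^ 2 with hB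
  have hB0 : 0 < B := by positivity
  have hmem0 : ζ₀ ∈ Metric.ball ζ₀ η := Metric.mem_ball_self hη
  refine ⟨η, hη, max B (B * (ρ / 8) ^ 3), hηp, fun n Φ hΦ => ?_⟩
  obtain ⟨k, hk, hkb, hkN⟩ := hS.exists_local_factor hΦ hζ₀ hρ hball
  have hfac := hkN _ hηp (convex_ball ζ₀ η).isPreconnected hmem0 fun ζ hζ =>
    Metric.ball_subset_ball (by linarith) (hηE hζ)
  have hcmp : ∀ y ∈ Metric.ball (expParam ξ H ζ₀) (ρ / 8),
      ∀ y' ∈ Metric.ball (expParam ξ H ζ₀) (ρ / 8), ‖deriv k y'‖ ^ 3 ≤ B * ‖deriv k y‖ :=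
    fun y hy y' hy' => norm_deriv_pow_three_le hρ hr hk (fun z hz => (hkb z hz).1)
      (fun z hz => (hkb z hz).2.1) hy hy'
  have hnn : ∀ ζ, 0 ≤ inverseBranchDeriv f ξ n Φ ζ := fun ζ => norm_nonneg _
  refine ⟨fun ζ hζ ζ' hζ' => ?_, fun ζ hζ => ?_⟩
  · refine le_trans ?_ (mul_le_mul_of_nonneg_right (le_max_left _ _) (hnn ζ))
    rw [(hfac ζ hζ).2, (hfac ζ' hζ').2]
    exact hcmp _ (hηE hζ) _ (hηE hζ')
  · refine le_trans ?_ (mul_le_mul_of_nonneg_right (le_max_right _ _) (hnn ζ₀))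
    rw [(hfac ζ hζ).1, (hfac ζ₀ hmem0).1, (hfac ζ₀ hmem0).2]
    set w := expParam ξ H ζ₀ with hw
    have hw8 : w ∈ Metric.ball w (ρ / 8) := Metric.mem_ball_self (by linarith)
    set b : ℝ := (B * ‖deriv k w‖) ^ ((1 : ℝ) / 3) with hb
    have hbn : 0 ≤ B * ‖deriv k w‖ := by positivity
    have hb3 : b ^ 3 = B * ‖deriv k w‖ := by
      rw [hb, ← Real.rpow_natCast, ← Real.rpow_mul hbn]
      norm_num
    have hb0 : 0 ≤ b := Real.rpow_nonneg hbn _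
    have hbound : ∀ y ∈ Metric.ball w (ρ / 8), ‖deriv k y‖ ≤ b := fun y hy => by
      refine le_of_pow_le_pow_left₀ three_ne_zero hb0 ?_
      rw [hb3]; exact hcmp w hw8 y hy
    have hmv := (convex_ball w (ρ / 8)).norm_image_sub_le_of_norm_deriv_le (f := k) (C := b)
      (fun y hy => (hk.differentiableAt (Metric.isOpen_ball.mem_nhds
        (Metric.ball_subset_ball (by linarith) hy)))) hbound hw8 (hηE hζ)
    have hd : ‖expParam ξ H ζ - w‖ ≤ ρ / 8 := by
      rw [← dist_eq_norm]; exact le_of_lt (hηE hζ)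
    calc ‖k (expParam ξ H ζ) - k w‖ ^ 3 ≤ (b * (ρ / 8)) ^ 3 := by
          gcongr
          exact hmv.trans (by gcongr)
      _ = B * (ρ / 8) ^ 3 * ‖deriv k w‖ := by rw [mul_pow, hb3]; ring

theorem mem_basin_of_iterate_mem {n : ℕ} {x : ℂ} (h : ∀ k < n, ¬ IsPole f (f^[k] x))
    (hx : f^[n] x ∈ basin f ξ) : x ∈ basin f ξ := by
  refine ⟨fun k => ?_, ?_⟩
  · rcases lt_or_ge k n with hk | hk
    · exact h k hk
    · have := hx.1 (k - n)
      rwa [← Function.iterate_add_apply, Nat.sub_add_cancel hk] at this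
  · refine (tendsto_add_atTop_iff_nat n).1 ?_
    refine hx.2.congr fun k => ?_
    rw [← Function.iterate_add_apply]

/-- Over points of the basin the derivatives of the inverse branches tend to `0`. -/
theorem tendsto_inverseBranchDeriv_of_mem_basin (hS : PostsingularSetup f ξ r P H L M)
    {Φ : ℕ → ℂ → ℂ} (hΦ : ∀ n, IsParamLift f ξ r P H (n + 1) (Φ n)) {ζ₀ : ℂ}
    (hζ₀ : ζ₀ ∈ paramDomain r) (hb : expParam ξ H ζ₀ ∈ basin f ξ) :
    Tendsto (fun n => inverseBranchDeriv f ξ (n + 1) (Φ n) ζ₀) atTop (𝓝 0) := by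
  have hr : 0 < 1 / r := one_div_pos.2 hS.r_pos
  obtain ⟨ρ, hρ, hball⟩ := Metric.isOpen_iff.1
    (hS.isClosed.isOpen_compl.inter hS.isOpen_basin) _ ⟨hS.mapsTo_expParam hζ₀, hb⟩
  set w := expParam ξ H ζ₀ with hw
  rw [Metric.tendsto_atTop']
  by_contra! hcon
  obtain ⟨c, hc, hfreq⟩ := hcon
  have hfreq' : ∃ᶠ n in atTop, c ≤ inverseBranchDeriv f ξ (n + 1) (Φ n) ζ₀ :=
    frequently_atTop.2 fun N => by
      obtain ⟨n, hn, h⟩ := hfreq N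
      refine ⟨n, hn.le, ?_⟩
      have hnn : 0 ≤ inverseBranchDeriv f ξ (n + 1) (Φ n) ζ₀ := norm_nonneg _
      rwa [dist_zero_right, Real.norm_of_nonneg hnn] at h
  obtain ⟨s, hs, himg⟩ := exists_ball_subset_image hρ hr hc
  set F : Filter ℕ := atTop ⊓ 𝓟 {n | c ≤ inverseBranchDeriv f ξ (n + 1) (Φ n) ζ₀} with hF
  have : F.NeBot := frequently_mem_iff_neBot.1 hfreq'
  obtain ⟨y, -, hy⟩ := (isCompact_closedBall (0 : ℂ) (1 / r)).exists_mapClusterPt_of_frequently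
    (l := F) (f := fun n => (Φ n ζ₀ - ξ)⁻¹) (Eventually.frequently (Eventually.of_forall fun n => by
      rw [mem_closedBall_zero_iff]; exact hS.norm_inv_le ((hΦ n).mem ζ₀ hζ₀)))
  have hfy : ∃ᶠ n in F, (Φ n ζ₀ - ξ)⁻¹ ∈ Metric.ball y s :=
    mapClusterPt_iff_frequently.1 hy _ (Metric.ball_mem_nhds y hs)
  have hfx : ∃ᶠ n in atTop, ξ + y⁻¹ ∈ iterDomain f P (n + 1) ∧
      f^[n + 1] (ξ + y⁻¹) ∈ basin f ξ := by
    have h1 : ∃ᶠ n in atTop, (Φ n ζ₀ - ξ)⁻¹ ∈ Metric.ball y s ∧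
        c ≤ inverseBranchDeriv f ξ (n + 1) (Φ n) ζ₀ := by
      rw [hF, frequently_inf_principal] at hfy
      exact hfy.mono fun n hn => ⟨hn.2, hn.1⟩
    refine h1.mono fun n hn => ?_
    obtain ⟨k, hk, hkb, hkN⟩ := hS.exists_local_factor (hΦ n) hζ₀ hρ fun x hx => (hball hx).1
    have h2 := hkN {ζ₀} (singleton_subset_iff.2 hζ₀) isPreconnected_singleton rfl
      (by rintro _ rfl; exact Metric.mem_ball_self hρ) ζ₀ rfl
    rw [h2.1, h2.2] at hn
    obtain ⟨v, hv, hvy⟩ := himg k w hk (fun z hz => (hkb z hz).1) hn.2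
      (show y ∈ Metric.ball (k w) s by rw [Metric.mem_ball, dist_comm]; exact hn.1)
    obtain ⟨-, -, x, hx, hxv, hkx⟩ := hkb v hv
    have h3 : ξ + y⁻¹ = x := by
      rw [← hvy, hkx, inv_inv]; ring
    rw [h3]
    exact ⟨hx, by rw [hxv]; exact (hball hv).2⟩
  obtain ⟨n, hn, hnb⟩ := hfx.exists
  have hxb : ξ + y⁻¹ ∈ basin f ξ := mem_basin_of_iterate_mem (hS.mem_iterDomain_iff.1 hn).1 hnb
  have hev : ∀ᶠ n in atTop, f^[n + 1] (ξ + y⁻¹) ∈ P := by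
    have h4 := (tendsto_add_atTop_iff_nat 1).2 hxb.2
    filter_upwards [h4.eventually (Metric.closedBall_mem_nhds ξ hS.r_pos)] with n hn
    exact hS.closedBall_subset hn
  obtain ⟨n, h5, h6⟩ := (hfx.and_eventually hev).exists
  exact (hS.mem_iterDomain_iff.1 h5.1).2 h6

/-- The derivatives of the inverse branches tend to `0` everywhere. -/
theorem tendsto_inverseBranchDeriv (hS : PostsingularSetup f ξ r P H L M)
    {Φ : ℕ → ℂ → ℂ} (hΦ : ∀ n, IsParamLift f ξ r P H (n + 1) (Φ n)) {ζ : ℂ}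
    (hζ : ζ ∈ paramDomain r) :
    Tendsto (fun n => inverseBranchDeriv f ξ (n + 1) (Φ n) ζ) atTop (𝓝 0) := by
  have hr := hS.r_pos
  set ζ₀ : ℂ := ((Real.log (3 * r) : ℝ) : ℂ) with hζ₀
  have h0 : ζ₀ ∈ paramDomain r := hS.mem_paramDomain (by rw [hζ₀, Complex.ofReal_re])
  have hb : expParam ξ H ζ₀ ∈ basin f ξ := hS.mem_basin _ (by
    rw [dist_apply_expParam, hζ₀, Complex.ofReal_re, Real.exp_log (by linarith)])
  have hstep : ∀ C : ℝ, ∀ ζ ζ' : ℂ, (∀ n, inverseBranchDeriv f ξ (n + 1) (Φ n) ζ' ^ 3 ≤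
      C * inverseBranchDeriv f ξ (n + 1) (Φ n) ζ) →
      Tendsto (fun n => inverseBranchDeriv f ξ (n + 1) (Φ n) ζ) atTop (𝓝 0) →
      Tendsto (fun n => inverseBranchDeriv f ξ (n + 1) (Φ n) ζ') atTop (𝓝 0) := by
    intro C ζ ζ' h ht
    have h1 : Tendsto (fun n => inverseBranchDeriv f ξ (n + 1) (Φ n) ζ' ^ 3) atTop (𝓝 0) :=
      squeeze_zero (fun n => pow_nonneg (norm_nonneg _) 3) h (by simpa using ht.const_mul C)
    exact tendsto_zero_of_pow (fun n => norm_nonneg _) h1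
  exact (convex_paramDomain r).isPreconnected.induction₂
    (fun x y => Tendsto (fun n => inverseBranchDeriv f ξ (n + 1) (Φ n) x) atTop (𝓝 0) ↔
      Tendsto (fun n => inverseBranchDeriv f ξ (n + 1) (Φ n) y) atTop (𝓝 0))
    (fun x hx => by
      obtain ⟨η, hη, C, -, hC⟩ := hS.exists_local_bounds hx
      filter_upwards [mem_nhdsWithin_of_mem_nhds (Metric.ball_mem_nhds x hη)] with y hy
      have hx' := Metric.mem_ball_self (x := x) hη
      exact ⟨hstep C x y fun n => (hC _ _ (hΦ n)).1 x hx' y hy,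
        hstep C y x fun n => (hC _ _ (hΦ n)).1 y hy x hx'⟩)
    (fun x y z _ _ _ h h' => h.trans h') (fun x y _ _ h => h.symm) h0 hζ |>.1
    (hS.tendsto_inverseBranchDeriv_of_mem_basin hΦ h0 hb)

end PostsingularSetup

namespace PostsingularSetup

variable {f : ℂ → ℂ} {ξ : ℂ} {r : ℝ} {P : Set ℂ} {H : ℂ ≃ₜ ℂ} {L : ℝ} {M : ℕ}

theorem tendsto_norm_sub_lift (hS : PostsingularSetup f ξ r P H L M)
    {Φ : ℕ → ℂ → ℂ} (hΦ : ∀ n, IsParamLift f ξ r P H (n + 1) (Φ n)) {ζ ζ' : ℂ}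
    (hζ : ζ ∈ paramDomain r) (hζ' : ζ' ∈ paramDomain r) :
    Tendsto (fun n => ‖(Φ n ζ - ξ)⁻¹ - (Φ n ζ' - ξ)⁻¹‖) atTop (𝓝 0) := by
  refine (convex_paramDomain r).isPreconnected.induction₂
    (fun x y => Tendsto (fun n => ‖(Φ n x - ξ)⁻¹ - (Φ n y - ξ)⁻¹‖) atTop (𝓝 0))
    (fun x hx => ?_) (fun x y z _ _ _ h h' => ?_) (fun x y _ _ h => ?_) hζ hζ'
  · obtain ⟨η, hη, C, -, hC⟩ := hS.exists_local_bounds hx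
    filter_upwards [mem_nhdsWithin_of_mem_nhds (Metric.ball_mem_nhds x hη)] with y hy
    refine tendsto_zero_of_pow (k := 3) (fun n => norm_nonneg _) (squeeze_zero
      (fun n => pow_nonneg (norm_nonneg _) 3) (fun n => ?_)
      (by simpa using (hS.tendsto_inverseBranchDeriv hΦ hx).const_mul C))
    rw [norm_sub_rev]
    exact (hC _ _ (hΦ n)).2 y hy
  · exact squeeze_zero (fun n => norm_nonneg _) (fun n => norm_sub_le_norm_sub_add_norm_sub _ _ _)
      (by simpa using h.add h')
  · simpa only [norm_sub_rev] using h

theorem eventually_norm_sub_lift_le (hS : PostsingularSetup f ξ r P H L M)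
    {Φ : ℕ → ℂ → ℂ} (hΦ : ∀ n, IsParamLift f ξ r P H (n + 1) (Φ n)) {K : Set ℂ} (hK : IsCompact K)
    (hKp : K ⊆ paramDomain r) {ζ₁ : ℂ} (hζ₁ : ζ₁ ∈ paramDomain r) {ε : ℝ} (hε : 0 < ε) :
    ∀ᶠ n in atTop, ∀ ζ ∈ K, ‖(Φ n ζ - ξ)⁻¹ - (Φ n ζ₁ - ξ)⁻¹‖ ≤ ε := by
  refine hK.induction_on (p := fun s => ∀ᶠ n in atTop, ∀ ζ ∈ s,
    ‖(Φ n ζ - ξ)⁻¹ - (Φ n ζ₁ - ξ)⁻¹‖ ≤ ε) (by simp) (fun s t hst ht => ?_) (fun s t hs ht => ?_)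
    fun x hx => ?_
  · exact ht.mono fun n hn ζ hζ => hn ζ (hst hζ)
  · filter_upwards [hs, ht] with n h1 h2 ζ hζ
    exact hζ.elim (h1 ζ) (h2 ζ)
  · obtain ⟨η, hη, C, -, hC⟩ := hS.exists_local_bounds (hKp hx)
    refine ⟨_, mem_nhdsWithin_of_mem_nhds (Metric.ball_mem_nhds x hη), ?_⟩
    have h1 : Tendsto (fun n => C * inverseBranchDeriv f ξ (n + 1) (Φ n) x) atTop (𝓝 0) := by
      simpa using (hS.tendsto_inverseBranchDeriv hΦ (hKp hx)).const_mul C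
    have h2 : 0 < (ε / 2) ^ 3 := by positivity
    filter_upwards [h1.eventually (gt_mem_nhds h2),
      (hS.tendsto_norm_sub_lift hΦ (hKp hx) hζ₁).eventually (gt_mem_nhds (half_pos hε))]
      with n hn1 hn2 ζ hζ
    have h3 := lt_of_pow_lt_pow_left₀ 3 (half_pos hε).le
      (((hC _ _ (hΦ n)).2 ζ hζ).trans_lt hn1)
    linarith [norm_sub_le_norm_sub_add_norm_sub ((Φ n ζ - ξ)⁻¹) ((Φ n x - ξ)⁻¹)
      ((Φ n ζ₁ - ξ)⁻¹)]

/-- Every value of a lift is taken in a horizontal strip of finite height. -/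
theorem exists_im_mem_Icc (hS : PostsingularSetup f ξ r P H L M) {n : ℕ} {Φ : ℂ → ℂ}
    (hΦ : IsParamLift f ξ r P H (n + 1) Φ) {ζ : ℂ} (hζ : ζ ∈ paramDomain r) :
    ∃ ζ' : ℂ, ζ'.re = ζ.re ∧ ζ'.im ∈ Icc 0 (M.factorial * (2 * Real.pi)) ∧ Φ ζ' = Φ ζ := by
  set T : ℝ := M.factorial * (2 * Real.pi) with hT
  have hT0 : 0 < T := by positivity
  set m : ℤ := ⌊ζ.im / T⌋ with hm
  have hm1 : m * T ≤ ζ.im := (le_div_iff₀ hT0).1 (Int.floor_le _)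
  have hm2 : ζ.im < (m + 1) * T := (div_lt_iff₀ hT0).1 (Int.lt_floor_add_one _)
  have hre : (ζ - (m * T : ℝ) * Complex.I).re = ζ.re := by simp
  refine ⟨ζ - (m * T : ℝ) * Complex.I, hre, ?_, ?_⟩
  · have : (ζ - (m * T : ℝ) * Complex.I).im = ζ.im - m * T := by
      rw [Complex.sub_im, Complex.im_ofReal_mul]; simp
    rw [this]
    constructor <;> linarith
  · obtain ⟨k, h | h⟩ := m.eq_nat_or_neg
    · rw [← hS.lift_periodic hΦ (show ζ - (m * T : ℝ) * Complex.I ∈ paramDomain r by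
        change Real.log (2 * r) < _; rw [hre]; exact hζ) k]
      congr 1
      rw [h]
      push_cast [hT]
      ring
    · rw [← hS.lift_periodic hΦ hζ k]
      congr 1
      rw [h]
      push_cast [hT]
      ring

theorem differentiableAt_inv_lift (hS : PostsingularSetup f ξ r P H L M) {n : ℕ} {Φ : ℂ → ℂ}
    (hΦ : IsParamLift f ξ r P H n Φ) {ζ₀ : ℂ} (hζ₀ : L < ζ₀.re) :
    DifferentiableAt ℂ (fun ζ => (Φ ζ - ξ)⁻¹) ζ₀ := by
  have h0 : ζ₀ ∈ paramDomain r := hS.mem_paramDomain (hS.log_le.trans hζ₀.le)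
  obtain ⟨ρ, hρ, hball⟩ := Metric.isOpen_iff.1 hS.isClosed.isOpen_compl _ (hS.mapsTo_expParam h0)
  obtain ⟨k, hk, -, hkN⟩ := hS.exists_local_factor hΦ h0 hρ hball
  obtain ⟨η, hη, hηp, hηE⟩ := exists_ball_mapsTo ξ H h0 hρ
  have hfac := hkN _ hηp (convex_ball ζ₀ η).isPreconnected (Metric.mem_ball_self hη) hηE
  have h1 : (fun ζ => (Φ ζ - ξ)⁻¹) =ᶠ[𝓝 ζ₀] fun ζ => k (ξ + Complex.exp ζ) := by
    filter_upwards [Metric.ball_mem_nhds ζ₀ hη,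
      (isOpen_lt continuous_const Complex.continuous_re).mem_nhds hζ₀] with ζ h2 h3
    rw [(hfac ζ h2).1, hS.expParam_eq (le_of_lt h3)]
  refine DifferentiableAt.congr_of_eventuallyEq ?_ h1
  have h2 : DifferentiableAt ℂ k (ξ + Complex.exp ζ₀) := by
    rw [← hS.expParam_eq hζ₀.le]
    exact hk.differentiableAt (Metric.ball_mem_nhds _ hρ)
  exact h2.comp ζ₀ (by fun_prop)

/-- The lifts become uniformly close to constants on a closed half-plane. -/
theorem eventually_forall_norm_sub_lift_le (hS : PostsingularSetup f ξ r P H L M)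
    {Φ : ℕ → ℂ → ℂ} (hΦ : ∀ n, IsParamLift f ξ r P H (n + 1) (Φ n)) {ε : ℝ} (hε : 0 < ε) :
    ∀ᶠ n in atTop, ∀ ζ : ℂ, Real.log (3 * r) ≤ ζ.re →
      ‖(Φ n ζ - ξ)⁻¹ - (Φ n L - ξ)⁻¹‖ ≤ ε := by
  have hL : (L : ℂ) ∈ paramDomain r := hS.mem_paramDomain (by simpa using hS.log_le)
  have hK : IsCompact (Icc (Real.log (3 * r)) L ×ℂ Icc 0 (M.factorial * (2 * Real.pi))) :=
    isCompact_Icc.reProdIm isCompact_Icc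
  filter_upwards [hS.eventually_norm_sub_lift_le hΦ hK
    (fun ζ hζ => hS.mem_paramDomain hζ.1.1) hL hε] with n hn
  have hle : ∀ ζ : ℂ, ζ.re ∈ Icc (Real.log (3 * r)) L →
      ‖(Φ n ζ - ξ)⁻¹ - (Φ n L - ξ)⁻¹‖ ≤ ε := fun ζ hζ => by
    obtain ⟨ζ', h1, h2, h3⟩ := hS.exists_im_mem_Icc (hΦ n) (hS.mem_paramDomain hζ.1)
    rw [← h3]
    exact hn ζ' ⟨by rw [mem_preimage, h1]; exact hζ, h2⟩
  intro ζ hζ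
  rcases le_total ζ.re L with h | h
  · exact hle ζ ⟨hζ, h⟩
  have hmem : ∀ z : ℂ, 0 ≤ z.re → z + L ∈ paramDomain r := fun z hz =>
    hS.mem_paramDomain (by have := hS.log_le; simp; linarith)
  have hb : ∀ z : ℂ, 0 ≤ z.re →
      ‖(Φ n (z + L) - ξ)⁻¹ - (Φ n L - ξ)⁻¹‖ ≤ 1 / r + 1 / r := fun z hz =>
    (norm_sub_le _ _).trans (add_le_add (hS.norm_inv_le ((hΦ n).mem _ (hmem z hz)))
      (hS.norm_inv_le ((hΦ n).mem _ hL)))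
  have hcl : closure {z : ℂ | 0 < z.re} ⊆ {z : ℂ | 0 ≤ z.re} :=
    closure_minimal (fun z hz => le_of_lt (show 0 < z.re from hz))
      (isClosed_le continuous_const Complex.continuous_re)
  have key := PhragmenLindelof.right_half_plane_of_bounded_on_real
    (f := fun z => (Φ n (z + L) - ξ)⁻¹ - (Φ n L - ξ)⁻¹) (C := ε) (z := ζ - L) ?_ ?_ ?_ ?_ ?_
  · simpa using key
  · refine ⟨fun z hz => ?_, ?_⟩
    · have h1 : L < (z + L).re := by simpa using hz
      exact ((DifferentiableAt.comp z (hS.differentiableAt_inv_lift (hΦ n) h1)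
        (differentiableAt_id.add_const (L : ℂ))).sub_const _).differentiableWithinAt
    · refine ContinuousOn.sub (ContinuousOn.inv₀ (ContinuousOn.sub ((hΦ n).continuousOn.comp
        (by fun_prop) fun z hz => hmem z (hcl hz)) continuousOn_const) fun z hz => ?_)
        continuousOn_const
      exact norm_pos_iff.1 (hS.r_pos.trans
        (hS.lt_dist_of_mem_iterDomain ((hΦ n).mem _ (hmem z (hcl hz)))))
  · refine ⟨1, one_lt_two, 0, Asymptotics.IsBigO.of_bound (1 / r + 1 / r) ?_⟩
    refine eventually_inf_principal.2 (Eventually.of_forall fun z hz => ?_)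
    simpa using hb z (le_of_lt hz)
  · refine isBoundedUnder_of_eventually_le (a := 1 / r + 1 / r) ?_
    filter_upwards [eventually_ge_atTop 0] with x hx
    exact hb x (by simpa using hx)
  · intro x
    exact hle _ (by simpa using hS.log_le)
  · simpa using h

end PostsingularSetup

theorem isPreconnected_ball_sdiff_singleton (p : ℂ) {δ : ℝ} (hδ : 0 < δ) :
    IsPreconnected (Metric.ball p δ \ {p}) := by
  have h : Metric.ball p δ \ {p} = (fun ζ => p + Complex.exp ζ) '' {ζ | ζ.re < Real.log δ} := by
    ext z
    constructor
    · rintro ⟨h1, h2⟩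
      have h3 : z - p ≠ 0 := sub_ne_zero.2 h2
      refine ⟨Complex.log (z - p), ?_, ?_⟩
      · change (Complex.log (z - p)).re < _
        rw [Complex.log_re]
        refine Real.log_lt_log (norm_pos_iff.2 h3) ?_
        rwa [← dist_eq_norm]
      · simp only [Complex.exp_log h3, add_sub_cancel]
    · rintro ⟨ζ, hζ, rfl⟩
      refine ⟨?_, by simp [Complex.exp_ne_zero]⟩
      rw [Metric.mem_ball, dist_self_add_left, Complex.norm_exp]
      exact (Real.lt_log_iff_exp_lt hδ).1 hζ
  rw [h]
  exact (convex_halfSpace_re_lt _).isPreconnected.image _ (by fun_prop)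

namespace PostsingularSetup

variable {f : ℂ → ℂ} {ξ : ℂ} {r : ℝ} {P : Set ℂ} {H : ℂ ≃ₜ ℂ} {L : ℝ} {M : ℕ}

theorem subset_basin (hS : PostsingularSetup f ξ r P H L M) : P ⊆ basin f ξ := fun z hz =>
  hS.mem_basin z ((hS.dist_le z hz).trans (by linarith [hS.r_pos]))

theorem mem_iterDomain_one (hS : PostsingularSetup f ξ r P H L M) {z : ℂ} (hz : ¬ IsPole f z)
    (h : f z ∉ P) : z ∈ iterDomain f P 1 :=
  hS.mem_iterDomain_iff.2 ⟨fun k hk => by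
    obtain rfl : k = 0 := by omega
    exact hz, h⟩

theorem isOpen_insert_image_lift (hS : PostsingularSetup f ξ r P H L M) {Φ : ℂ → ℂ}
    (hΦ : IsParamLift f ξ r P H 1 Φ) {p : ℂ} (hp : IsPole f p)
    (hlim : ∀ δ > 0, ∃ l : ℝ, ∀ ζ : ℂ, l < ζ.re → Φ ζ ∈ Metric.ball p δ) :
    IsOpen (insert p (Φ '' paramDomain r)) := by
  have hfar : ∀ᶠ y in 𝓝[≠] p, ¬ IsPole f y ∧ Real.exp L < dist (f y) ξ := by
    have h1 : ((↑) '' Metric.closedBall ξ (Real.exp L) : Set (OnePoint ℂ))ᶜ ∈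
        𝓝 (toSphere f p) := by
      rw [toSphere_of_isPole hp]
      exact (OnePoint.isOpen_compl_image_coe.2 ⟨Metric.isClosed_closedBall,
        isCompact_closedBall _ _⟩).mem_nhds OnePoint.infty_notMem_image_coe
    have h2 := (continuous_toSphere hS.nf).continuousAt.preimage_mem_nhds h1
    filter_upwards [mem_nhdsWithin_of_mem_nhds h2, eventually_not_isPole hS.nf p] with y h3 h4
    refine ⟨h4, not_le.1 fun h => h3 ?_⟩
    rw [toSphere_of_not_isPole h4]
    exact mem_image_of_mem _ h
  obtain ⟨δ, hδ, hball⟩ := Metric.mem_nhdsWithin_iff.1 hfar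
  have hCE : ∀ z ∈ Metric.ball p δ \ {p}, ¬ IsPole f z ∧
      ∃ ζ ∈ paramDomain r, f z = expParam ξ H ζ := fun z hz => by
    obtain ⟨h4, hw⟩ := hball hz
    have hH : H (f z) = f z := hS.eq_self _ hw.le
    have hpos := Real.exp_pos L
    obtain ⟨ζ, h6, h7⟩ := exists_expParam_eq (H := H) (ξ := ξ) (z := f z)
      (by rw [hH]; exact dist_pos.1 (hpos.trans hw))
    refine ⟨h4, ζ, hS.mem_paramDomain ?_, h6.symm⟩
    rw [h7, hH]
    exact hS.log_le.trans ((Real.lt_log_iff_exp_lt (hpos.trans hw)).2 hw).le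
  have hsub : Metric.ball p δ \ {p} ⊆ Φ '' paramDomain r := by
    refine hS.subset_image_lift hΦ (isPreconnected_ball_sdiff_singleton p hδ) (fun z hz => ?_)
      (fun z hz => (hCE z hz).2) ?_
    · obtain ⟨h1, ζ, h2, h3⟩ := hCE z hz
      exact hS.mem_iterDomain_one h1 (by rw [h3]; exact hS.mapsTo_expParam h2)
    · obtain ⟨l, hl⟩ := hlim δ hδ
      have hmem : ((max (l + 1) L : ℝ) : ℂ) ∈ paramDomain r :=
        hS.mem_paramDomain (by simpa using Or.inr hS.log_le)
      refine ⟨_, ⟨hl ((max (l + 1) L : ℝ) : ℂ) (by simp), ?_⟩, mem_image_of_mem Φ hmem⟩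
      intro h
      rw [mem_singleton_iff] at h
      exact (hS.mem_iterDomain_iff.1 (hΦ.mem _ hmem)).1 0 zero_lt_one (by rw [h]; exact hp)
  rw [isOpen_iff_mem_nhds]
  rintro x (rfl | hx)
  · refine mem_of_superset (Metric.ball_mem_nhds x hδ) fun y hy => ?_
    rcases eq_or_ne y x with rfl | hyx
    · exact mem_insert _ _
    · exact Or.inr (hsub ⟨hy, hyx⟩)
  · exact mem_of_superset ((hS.isOpen_image_lift hΦ).mem_nhds hx) (subset_insert _ _)

theorem isCompact_insert_image_lift (hS : PostsingularSetup f ξ r P H L M) {Φ : ℂ → ℂ}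
    (hΦ : IsParamLift f ξ r P H 1 Φ) {p : ℂ}
    (hlim : ∀ δ > 0, ∃ l : ℝ, ∀ ζ : ℂ, l < ζ.re → Φ ζ ∈ Metric.ball p δ) :
    IsCompact (insert p (Φ '' {ζ | Real.log (3 * r) ≤ ζ.re})) := by
  intro F hF hle
  by_cases hcl : ClusterPt p F
  · exact ⟨p, mem_insert _ _, hcl⟩
  obtain ⟨s, hs, t, ht, hst⟩ := Filter.disjoint_iff.1 (disjoint_iff.2 (not_neBot.1 hcl))
  obtain ⟨δ, hδ, hball⟩ := Metric.mem_nhds_iff.1 hs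
  obtain ⟨l, hl⟩ := hlim δ hδ
  have hK : IsCompact
      (Φ '' (Icc (Real.log (3 * r)) l ×ℂ Icc 0 (M.factorial * (2 * Real.pi)))) :=
    (isCompact_Icc.reProdIm isCompact_Icc).image_of_continuousOn
      (hΦ.continuousOn.mono fun ζ hζ => hS.mem_paramDomain hζ.1.1)
  have hmem : Φ '' (Icc (Real.log (3 * r)) l ×ℂ Icc 0 (M.factorial * (2 * Real.pi))) ∈ F := by
    filter_upwards [ht, le_principal_iff.1 hle] with z hzt hz
    have hzs : z ∉ s := fun h => disjoint_left.1 hst h hzt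
    rcases hz with rfl | ⟨ζ, hζ, rfl⟩
    · exact absurd (mem_of_mem_nhds hs) hzs
    · obtain ⟨ζ', h1, h2, h3⟩ := hS.exists_im_mem_Icc (n := 0) hΦ (hS.mem_paramDomain hζ)
      refine ⟨ζ', ⟨⟨?_, ?_⟩, h2⟩, h3⟩
      · rw [h1]; exact hζ
      · rw [h1]
        exact not_lt.1 fun h => hzs (hball (hl ζ h))
  obtain ⟨x, hx, hxF⟩ := hK (le_principal_iff.2 hmem)
  exact ⟨x, Or.inr (image_mono (fun ζ hζ => hζ.1.1) hx), hxF⟩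

/-- A point of the plane other than a pole outside the basin lies in the image of a lift. -/
theorem exists_lift_of_notMem_basin (hS : PostsingularSetup f ξ r P H L M) {n : ℕ} {c : ℂ}
    (hp : ∀ k < n, ¬ IsPole f (f^[k] c)) (hc : f^[n] c ∉ basin f ξ) :
    ∃ Φ ζ, IsParamLift f ξ r P H n Φ ∧ Real.log (3 * r) ≤ ζ.re ∧ Φ ζ = c := by
  obtain ⟨ζ, h1, h2⟩ := hS.exists_expParam_eq_of_notMem_basin hc
  obtain ⟨Φ, h3, h4⟩ := hS.exists_lift (hS.mem_iterDomain_iff.2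
    ⟨hp, fun h => hc (hS.subset_basin h)⟩) (hS.mem_paramDomain h2) h1.symm
  exact ⟨Φ, ζ, h3, h2, h4⟩

theorem exists_not_isPole_mem (hS : PostsingularSetup f ξ r P H L M) {t : Set (OnePoint ℂ)}
    (ht : IsPreconnected t) (htn : t.Nontrivial) :
    ∃ c : ℂ, (c : OnePoint ℂ) ∈ t ∧ ¬ IsPole f c := by
  obtain ⟨x, hx, hxi⟩ := htn.exists_ne OnePoint.infty
  lift x to ℂ using hxi
  by_cases hp : IsPole f x
  · have h1 : AccPt (x : OnePoint ℂ) (𝓟 t) := ht.preperfect_of_nontrivial htn _ hx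
    rw [accPt_iff_frequently_nhdsNE, OnePoint.nhdsWithin_coe, frequently_map] at h1
    have h0 : ((↑) ⁻¹' {(x : OnePoint ℂ)}ᶜ : Set ℂ) = {x}ᶜ := by
      ext y; simp
    rw [h0] at h1
    obtain ⟨c, h2, h3⟩ := (h1.and_eventually (eventually_not_isPole hS.nf x)).exists
    exact ⟨c, h2, h3⟩
  · exact ⟨x, hx, hp⟩

/-- In the complement of the basin, `∞` is a connected component. -/
theorem subset_singleton_infty (hS : PostsingularSetup f ξ r P H L M) {t : Set (OnePoint ℂ)}
    (ht : IsPreconnected t) (htb : t ⊆ ((↑) '' basin f ξ)ᶜ) (hti : OnePoint.infty ∈ t) :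
    t ⊆ {OnePoint.infty} := by
  by_contra hcon
  obtain ⟨x, hx, hxi⟩ := not_subset.1 hcon
  obtain ⟨c, hct, hcp⟩ := hS.exists_not_isPole_mem ht ⟨x, hx, _, hti, hxi⟩
  have hnb : ∀ z : ℂ, (z : OnePoint ℂ) ∈ t → z ∉ basin f ξ := fun z hz hzb =>
    htb hz (mem_image_of_mem _ hzb)
  have hfb : ∀ z : ℂ, (z : OnePoint ℂ) ∈ t → ¬ IsPole f z → f z ∉ basin f ξ := fun z hz hzp h =>
    hnb z hz (mem_basin_of_iterate_mem (n := 1) (fun k hk => by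
      obtain rfl : k = 0 := by omega
      exact hzp) h)
  obtain ⟨Φ, ζ, hΦ, hζ, rfl⟩ := hS.exists_lift_of_notMem_basin (n := 1) (fun k hk => by
      obtain rfl : k = 0 := by omega
      exact hcp) (hfb c hct hcp)
  obtain ⟨p, hp, hlim⟩ := hS.exists_isPole_of_lift hΦ
  have hKc := (hS.isCompact_insert_image_lift hΦ hlim).image OnePoint.continuous_coe
  obtain ⟨y, hyt, ⟨w, hw, rfl⟩, hyK⟩ := ht _ _
    (OnePoint.isOpenMap_coe _ (hS.isOpen_insert_image_lift hΦ hp hlim)) hKc.isClosed.isOpen_compl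
    (fun y _ => by
      by_cases hy : y ∈ ((↑) '' insert p (Φ '' {ζ | Real.log (3 * r) ≤ ζ.re}) : Set (OnePoint ℂ))
      · exact Or.inl (image_mono (insert_subset_insert
          (image_mono fun ζ hζ => hS.mem_paramDomain hζ)) hy)
      · exact Or.inr hy)
    ⟨_, hct, mem_image_of_mem _ (Or.inr (mem_image_of_mem _ (hS.mem_paramDomain hζ)))⟩
    ⟨_, hti, OnePoint.infty_notMem_image_coe⟩
  refine hyK (mem_image_of_mem _ ?_)
  rcases hw with rfl | ⟨ζ', hζ', rfl⟩
  · exact mem_insert _ _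
  · refine Or.inr (mem_image_of_mem _ (hS.le_re_of_notMem_basin ?_))
    rw [← hΦ.eq ζ' hζ']
    exact hfb _ hyt ((hS.mem_iterDomain_iff.1 (hΦ.mem ζ' hζ')).1 0 zero_lt_one)

theorem image_of_isPreconnected (hS : PostsingularSetup f ξ r P H L M) {C : Set ℂ}
    (hC : IsPreconnected C) (hCn : C.Nontrivial) (hCb : Disjoint C (basin f ξ)) :
    (∀ z ∈ C, ¬ IsPole f z) ∧ IsPreconnected (f '' C) ∧ (f '' C).Nontrivial ∧
      Disjoint (f '' C) (basin f ξ) := by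
  have hb : ∀ z ∈ C, ¬ IsPole f z → f z ∉ basin f ξ := fun z hz hzp h =>
    disjoint_left.1 hCb hz (mem_basin_of_iterate_mem (n := 1) (fun k hk => by
      obtain rfl : k = 0 := by omega
      exact hzp) h)
  have hpre : IsPreconnected (toSphere f '' C) :=
    hC.image _ (continuous_toSphere hS.nf).continuousOn
  have hnt : (toSphere f '' C).Nontrivial := by
    by_contra h
    rw [not_nontrivial_iff] at h
    obtain ⟨x, hx⟩ := hCn.nonempty
    have h1 : AccPt x (𝓟 C) := hC.preperfect_of_nontrivial hCn _ hx
    rw [accPt_iff_frequently_nhdsNE] at h1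
    obtain ⟨y, h2, h3⟩ := (h1.and_eventually
      (eventually_toSphere_ne hS.nf hS.not_isRational x (toSphere f x))).exists
    exact h3 (h (mem_image_of_mem _ h2) (mem_image_of_mem _ hx))
  have hnp : ∀ z ∈ C, ¬ IsPole f z := fun z hz hzp => by
    refine hnt.not_subset_singleton (x := OnePoint.infty)
      (hS.subset_singleton_infty hpre ?_ ⟨z, hz, toSphere_of_isPole hzp⟩)
    rintro _ ⟨y, hy, rfl⟩ ⟨b, hbb, hby⟩
    obtain ⟨h1, h2⟩ := toSphere_eq_coe_iff.1 hby.symm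
    exact hb y hy h1 (h2 ▸ hbb)
  refine ⟨hnp, hC.image _ fun z hz =>
    (analyticAt_of_not_isPole hS.nf (hnp z hz)).continuousAt.continuousWithinAt, ?_, ?_⟩
  · obtain ⟨_, ⟨x, hx, rfl⟩, _, ⟨y, hy, rfl⟩, hxy⟩ := hnt
    rw [toSphere_of_not_isPole (hnp x hx), toSphere_of_not_isPole (hnp y hy)] at hxy
    exact ⟨_, mem_image_of_mem _ hx, _, mem_image_of_mem _ hy, fun h => hxy (by rw [h])⟩
  · rw [disjoint_left]
    rintro _ ⟨z, hz, rfl⟩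
    exact hb z hz (hnp z hz)

/-- The complement of the basin in the sphere is totally disconnected. -/
theorem isTotallyDisconnected_compl_basin (hS : PostsingularSetup f ξ r P H L M) :
    IsTotallyDisconnected ((↑) '' basin f ξ : Set (OnePoint ℂ))ᶜ := by
  intro t htb ht
  by_cases hti : OnePoint.infty ∈ t
  · exact subsingleton_singleton.anti (hS.subset_singleton_infty ht htb hti)
  by_contra hnt
  rw [not_subsingleton_iff] at hnt
  have htr : t ⊆ range ((↑) : ℂ → OnePoint ℂ) := fun x hx => by
    have hxi : x ≠ OnePoint.infty := fun h => hti (h ▸ hx)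
    lift x to ℂ using hxi
    exact mem_range_self x
  set C : Set ℂ := (↑) ⁻¹' t with hCdef
  have hCt : ((↑) '' C : Set (OnePoint ℂ)) = t := image_preimage_eq_of_subset htr
  have hC : IsPreconnected C :=
    ht.preimage_of_isOpenMap OnePoint.coe_injective OnePoint.isOpenMap_coe htr
  have hiter : ∀ n, IsPreconnected (f^[n] '' C) ∧ (f^[n] '' C).Nontrivial ∧
      Disjoint (f^[n] '' C) (basin f ξ) := fun n => by
    induction n with
    | zero =>
      rw [Function.iterate_zero, image_id]
      refine ⟨hC, ?_, disjoint_left.2 fun z hz hzb => htb hz (mem_image_of_mem _ hzb)⟩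
      rw [← hCt] at hnt
      exact nontrivial_of_image _ _ hnt
    | succ n ih =>
      rw [Function.iterate_succ', image_comp]
      exact (hS.image_of_isPreconnected ih.1 ih.2.1 ih.2.2).2
  have hnp : ∀ z ∈ C, ∀ n, ¬ IsPole f (f^[n] z) := fun z hz n =>
    (hS.image_of_isPreconnected (hiter n).1 (hiter n).2.1 (hiter n).2.2).1 _ (mem_image_of_mem _ hz)
  have hnb : ∀ z ∈ C, ∀ n, f^[n] z ∉ basin f ξ := fun z hz n =>
    disjoint_left.1 (hiter n).2.2 (mem_image_of_mem _ hz)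
  obtain ⟨a, ha, b, hb, hab⟩ := (hiter 0).2.1
  rw [Function.iterate_zero, image_id] at ha hb
  choose Φ ζ hΦ hζ hΦa using fun n => hS.exists_lift_of_notMem_basin (n := n + 1) (c := a)
    (fun k _ => hnp a ha k) (hnb a ha (n + 1))
  have hsub : ∀ n, ∃ ζ' : ℂ, Real.log (3 * r) ≤ ζ'.re ∧ Φ n ζ' = b := fun n => by
    have hex : ∀ z ∈ C, ∃ ζ' ∈ paramDomain r, f^[n + 1] z = expParam ξ H ζ' := fun z hz => by
      obtain ⟨ζ', h1, h2⟩ := hS.exists_expParam_eq_of_notMem_basin (hnb z hz (n + 1))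
      exact ⟨ζ', hS.mem_paramDomain h2, h1.symm⟩
    obtain ⟨ζ', h1, h2⟩ := hS.subset_image_lift (hΦ n) hC (fun z hz => hS.mem_iterDomain_iff.2
      ⟨fun k _ => hnp z hz k, fun h => hnb z hz _ (hS.subset_basin h)⟩) hex
      ⟨a, ha, ζ n, hS.mem_paramDomain (hζ n), hΦa n⟩ hb
    refine ⟨ζ', hS.le_re_of_notMem_basin ?_, h2⟩
    rw [← (hΦ n).eq ζ' h1, h2]
    exact hnb b hb _
  have hzero : ∀ ε > 0, ‖(a - ξ)⁻¹ - (b - ξ)⁻¹‖ ≤ ε := fun ε hε => by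
    obtain ⟨n, hn⟩ := (hS.eventually_forall_norm_sub_lift_le hΦ (half_pos hε)).exists
    obtain ⟨ζ', h1, h2⟩ := hsub n
    have h3 := hn _ (hζ n)
    have h4 := hn _ h1
    rw [hΦa n] at h3
    rw [h2, norm_sub_rev] at h4
    linarith [norm_sub_le_norm_sub_add_norm_sub ((a - ξ)⁻¹) ((Φ n L - ξ)⁻¹) ((b - ξ)⁻¹)]
  have h5 : (a - ξ)⁻¹ = (b - ξ)⁻¹ :=
    sub_eq_zero.1 (norm_le_zero_iff.1 (le_of_forall_pos_le_add fun ε hε => by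
      rw [zero_add]; exact hzero ε hε))
  exact hab (sub_left_inj.1 (inv_injective h5))

end PostsingularSetup

/-- `f` contracts the disc of radius `r` about its fixed point `ξ` by the factor `q < 1`. -/
structure IsContractedDisc (f : ℂ → ℂ) (ξ : ℂ) (r q : ℝ) : Prop where
  r_pos : 0 < r
  q_nonneg : 0 ≤ q
  q_lt_one : q < 1
  not_isPole : ∀ z ∈ Metric.closedBall ξ r, ¬ IsPole f z
  dist_le : ∀ z ∈ Metric.closedBall ξ r, dist (f z) ξ ≤ q * dist z ξ

theorem IsAttractingFixedPoint.exists_isContractedDisc {f : ℂ → ℂ} {ξ : ℂ}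
    (hf : MeromorphicNFOn f univ) (h : IsAttractingFixedPoint f ξ) :
    ∃ r q, IsContractedDisc f ξ r q := by
  obtain ⟨h1, h2, h3⟩ := h
  obtain ⟨q, hq1, hq2⟩ := exists_between h3
  have hd : HasDerivAt f (deriv f ξ) ξ :=
    (analyticAt_of_not_isPole hf h1).differentiableAt.hasDerivAt
  have h4 := hd.isLittleO.bound (sub_pos.2 hq1)
  obtain ⟨r, hr, hball⟩ := Metric.nhds_basis_closedBall.mem_iff.1
    (inter_mem h4 ((isOpen_not_isPole hf).mem_nhds h1))
  refine ⟨r, q, hr, (norm_nonneg _).trans hq1.le, hq2, fun z hz => (hball hz).2, fun z hz => ?_⟩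
  have h5 : ‖f z - f ξ - (z - ξ) • deriv f ξ‖ ≤ (q - ‖deriv f ξ‖) * ‖z - ξ‖ := (hball hz).1
  rw [h2] at h5
  rw [dist_eq_norm, dist_eq_norm]
  have h6 : ‖f z - ξ‖ ≤ ‖f z - ξ - (z - ξ) • deriv f ξ‖ + ‖(z - ξ) • deriv f ξ‖ :=
    norm_le_norm_sub_add _ _
  rw [norm_smul] at h6
  nlinarith

namespace IsContractedDisc

variable {f : ℂ → ℂ} {ξ : ℂ} {r q : ℝ}

theorem mono (h : IsContractedDisc f ξ r q) {r' : ℝ} (h0 : 0 < r') (hr : r' ≤ r) :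
    IsContractedDisc f ξ r' q where
  r_pos := h0
  q_nonneg := h.q_nonneg
  q_lt_one := h.q_lt_one
  not_isPole z hz := h.not_isPole z (Metric.closedBall_subset_closedBall hr hz)
  dist_le z hz := h.dist_le z (Metric.closedBall_subset_closedBall hr hz)

theorem apply_mem (h : IsContractedDisc f ξ r q) {z : ℂ} (hz : z ∈ Metric.closedBall ξ r) :
    f z ∈ Metric.closedBall ξ r :=
  (h.dist_le z hz).trans (le_trans (mul_le_of_le_one_left dist_nonneg h.q_lt_one.le) hz)

theorem iterate_mem (h : IsContractedDisc f ξ r q) {z : ℂ} (hz : z ∈ Metric.closedBall ξ r)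
    (n : ℕ) : f^[n] z ∈ Metric.closedBall ξ r :=
  MapsTo.iterate (fun _ => h.apply_mem) n hz

theorem dist_iterate_le (h : IsContractedDisc f ξ r q) {z : ℂ} (hz : z ∈ Metric.closedBall ξ r)
    (n : ℕ) : dist (f^[n] z) ξ ≤ q ^ n * r := by
  induction n with
  | zero => simpa using! hz
  | succ n ih =>
    rw [Function.iterate_succ_apply', pow_succ', mul_assoc]
    exact (h.dist_le _ (h.iterate_mem hz n)).trans (mul_le_mul_of_nonneg_left ih h.q_nonneg)

theorem tendsto_pow_mul (h : IsContractedDisc f ξ r q) :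
    Tendsto (fun n : ℕ => q ^ n * r) atTop (𝓝 0) := by
  simpa using (tendsto_pow_atTop_nhds_zero_of_lt_one h.q_nonneg h.q_lt_one).mul_const r

theorem closedBall_subset_basin (h : IsContractedDisc f ξ r q) :
    Metric.closedBall ξ r ⊆ basin f ξ := fun _ hz =>
  ⟨fun n => h.not_isPole _ (h.iterate_mem hz n), tendsto_iff_dist_tendsto_zero.2
    (squeeze_zero (fun _ => dist_nonneg) (fun n => h.dist_iterate_le hz n) h.tendsto_pow_mul)⟩

theorem isOpen_setOf_iterate_mem_ball (hf : MeromorphicNFOn f univ) (n : ℕ) :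
    IsOpen {z | (∀ k < n, ¬ IsPole f (f^[k] z)) ∧ f^[n] z ∈ Metric.ball ξ r} := by
  induction n with
  | zero =>
    convert! Metric.isOpen_ball (x := ξ) (ε := r) using 1
    ext z
    simp
  | succ n ih =>
    have hc : ContinuousOn f {z | ¬ IsPole f z} := fun z hz =>
      (analyticAt_of_not_isPole hf hz).continuousAt.continuousWithinAt
    convert! hc.isOpen_inter_preimage (isOpen_not_isPole hf) ih using 1
    ext z
    constructor
    · rintro ⟨h1, h2⟩
      exact ⟨h1 0 (by omega), fun k hk => h1 (k + 1) (by omega), h2⟩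
    · rintro ⟨h1, h2, h3⟩
      refine ⟨fun k hk => ?_, h3⟩
      rcases k with _ | k
      · exact h1
      · exact h2 k (by omega)

/-- Near a point of the basin the iterates enter the contracted disc simultaneously. -/
theorem exists_open_iterate_mem (hf : MeromorphicNFOn f univ) (h : IsContractedDisc f ξ r q)
    {z : ℂ} (hz : z ∈ basin f ξ) :
    ∃ U, IsOpen U ∧ z ∈ U ∧ U ⊆ basin f ξ ∧
      ∃ n, ∀ w ∈ U, f^[n] w ∈ Metric.closedBall ξ r := by
  obtain ⟨n, hn⟩ := (hz.2.eventually (Metric.ball_mem_nhds ξ h.r_pos)).exists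
  refine ⟨_, isOpen_setOf_iterate_mem_ball (ξ := ξ) (r := r) hf n, ⟨fun k _ => hz.1 k, hn⟩,
    fun w hw => PostsingularSetup.mem_basin_of_iterate_mem hw.1
      (h.closedBall_subset_basin (Metric.ball_subset_closedBall hw.2)),
    n, fun w hw => Metric.ball_subset_closedBall hw.2⟩

theorem isOpen_basin (hf : MeromorphicNFOn f univ) (h : IsContractedDisc f ξ r q) :
    IsOpen (basin f ξ) := isOpen_iff_mem_nhds.2 fun z hz => by
  obtain ⟨U, hU, hzU, hUb, -⟩ := h.exists_open_iterate_mem hf hz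
  exact mem_of_superset (hU.mem_nhds hzU) hUb

theorem apply_self (h : IsContractedDisc f ξ r q) : f ξ = ξ := by
  have h1 := h.dist_le ξ (Metric.mem_closedBall_self h.r_pos.le)
  rw [dist_self, mul_zero] at h1
  exact dist_le_zero.1 h1

theorem self_mem_basin (h : IsContractedDisc f ξ r q) : ξ ∈ basin f ξ :=
  h.closedBall_subset_basin (Metric.mem_closedBall_self h.r_pos.le)

theorem closedBall_subset_immediateBasin (h : IsContractedDisc f ξ r q) :
    Metric.closedBall ξ r ⊆ immediateBasin f ξ :=
  (convex_closedBall ξ r).isPreconnected.subset_connectedComponentIn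
    (Metric.mem_closedBall_self h.r_pos.le) h.closedBall_subset_basin

theorem mapsTo_immediateBasin (hf : MeromorphicNFOn f univ) (h : IsContractedDisc f ξ r q) :
    MapsTo f (immediateBasin f ξ) (immediateBasin f ξ) := by
  have hsub : immediateBasin f ξ ⊆ basin f ξ := connectedComponentIn_subset _ _
  have hpre : IsPreconnected (f '' immediateBasin f ξ) :=
    isPreconnected_connectedComponentIn.image _ fun z hz =>
      (analyticAt_of_not_isPole hf ((hsub hz).1 0)).continuousAt.continuousWithinAt
  rw [mapsTo_iff_image_subset]
  refine hpre.subset_connectedComponentIn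
    ⟨ξ, mem_connectedComponentIn h.self_mem_basin, h.apply_self⟩ ?_
  rintro _ ⟨z, hz, rfl⟩
  refine ⟨fun k => (hsub hz).1 (k + 1), ?_⟩
  exact (tendsto_add_atTop_iff_nat 1).2 (hsub hz).2

theorem exists_postsingularSetup {M : ℕ} (hf : f ∈ SpeiserClass) (h : IsContractedDisc f ξ r q)
    (hsing : ∀ a : ℂ, (a : OnePoint ℂ) ∈ singInv f → a ∈ immediateBasin f ξ)
    (hasymp : ¬ IsAsymptoticValue f OnePoint.infty)
    (hpoles : ∀ z, IsPole f z → ((-(M : ℤ) : ℤ) : WithTop ℤ) ≤ meromorphicOrderAt f z) :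
    ∃ P H L, PostsingularSetup f ξ (r / 4) P H L M := by
  obtain ⟨⟨hnf, hrat⟩, hfin⟩ := hf
  have hr := h.r_pos
  have h' : IsContractedDisc f ξ (r / 4) q := h.mono (by linarith) (by linarith)
  have hsub : immediateBasin f ξ ⊆ basin f ξ := connectedComponentIn_subset _ _
  have hUo : IsOpen (immediateBasin f ξ) := (h.isOpen_basin hnf).connectedComponentIn
  set S : Set ℂ := {a | (a : OnePoint ℂ) ∈ singInv f} with hS
  have hSf : S.Finite := hfin.preimage OnePoint.coe_injective.injOn
  have hN : ∀ a ∈ S, ∃ n, f^[n] a ∈ Metric.closedBall ξ (r / 4) := fun a ha =>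
    ((hsub (hsing a ha)).2.eventually (Metric.closedBall_mem_nhds ξ h'.r_pos)).exists
  choose! N hN using hN
  set S' : Set ℂ := ⋃ a ∈ S, (fun k => f^[k] a) '' Iic (N a) with hS'
  have hS'f : S'.Finite := hSf.biUnion fun a _ => (finite_Iic _).image _
  have hS'U : S' ⊆ immediateBasin f ξ := by
    refine iUnion₂_subset fun a ha => ?_
    rintro _ ⟨k, -, rfl⟩
    exact (h.mapsTo_immediateBasin hnf).iterate k (hsing a ha)
  obtain ⟨φ, K, hK, hKU, hφK, hφb, hφS⟩ := exists_homeomorph_image_subset_ball (ξ := ξ)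
    (ρ₁ := r / 4) (ρ₂ := 2 * (r / 4)) hUo isPreconnected_connectedComponentIn (by linarith)
    (by linarith) ((Metric.ball_subset_closedBall.trans
      (Metric.closedBall_subset_closedBall (by linarith))).trans
      h.closedBall_subset_immediateBasin) hS'f hS'U
  obtain ⟨B, hB⟩ := hK.isBounded.subset_closedBall ξ
  have hPU : Metric.closedBall ξ (r / 4) ∪ S' ⊆ immediateBasin f ξ :=
    union_subset h'.closedBall_subset_immediateBasin hS'U
  refine ⟨Metric.closedBall ξ (r / 4) ∪ S', φ, max (Real.log (3 * (r / 4))) B, ?_⟩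
  exact
  { nf := hnf
    not_isRational := hrat
    not_isAsymptoticValue := hasymp
    le_order := hpoles
    r_pos := h'.r_pos
    isClosed := Metric.isClosed_closedBall.union hS'f.isClosed
    closedBall_subset := subset_union_left
    not_isPole := fun z hz => (hsub (hPU hz)).1 0
    mapsTo := by
      rintro z (hz | hz)
      · exact Or.inl (h'.apply_mem hz)
      · obtain ⟨a, ha, k, hk, rfl⟩ := mem_iUnion₂.1 hz
        rcases (show k ≤ N a from hk).lt_or_eq with hk' | rfl
        · exact Or.inr (mem_iUnion₂.2 ⟨a, ha, k + 1, hk', Function.iterate_succ_apply' f k a⟩)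
        · exact Or.inl (h'.apply_mem (hN a ha))
    mem_of_singInv := fun a ha => Or.inr (mem_iUnion₂.2 ⟨a, ha, 0, Nat.zero_le _, rfl⟩)
    dist_le := by
      rintro z (hz | hz)
      · rw [hφb z hz]
        exact (Metric.mem_closedBall.1 hz).trans (by linarith)
      · exact (Metric.mem_ball.1 (hφS z hz)).le
    log_le := le_max_left _ _
    eq_self := fun z hz => hφK z fun hzK => by
      have h1 := Metric.mem_closedBall.1 (hB hzK)
      have h2 := Real.add_one_le_exp (max (Real.log (3 * (r / 4))) B)
      linarith [le_max_right (Real.log (3 * (r / 4))) B]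
    mem_basin := fun z hz => by
      by_cases hzK : z ∈ K
      · exact hsub (hKU hzK)
      · rw [hφK z hzK] at hz
        exact h.closedBall_subset_basin (Metric.mem_closedBall.2 (hz.trans (by linarith)))
    isOpen_basin := h.isOpen_basin hnf }

theorem tendstoUniformlyOn_iterate (h : IsContractedDisc f ξ r q) {U : Set ℂ} {n : ℕ}
    (hU : ∀ w ∈ U, f^[n] w ∈ Metric.closedBall ξ r) :
    TendstoUniformlyOn (fun (k : ℕ) (w : ℂ) => ((f^[k] w : ℂ) : OnePoint ℂ))
      (fun _ => (ξ : OnePoint ℂ)) atTop U := by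
  intro u hu
  have h1 : {y : ℂ | ((ξ : OnePoint ℂ), (y : OnePoint ℂ)) ∈ u} ∈ 𝓝 ξ :=
    OnePoint.continuous_coe.continuousAt.preimage_mem_nhds (mem_nhds_left _ hu)
  obtain ⟨ε, hε, hball⟩ := Metric.mem_nhds_iff.1 h1
  obtain ⟨m, hm⟩ := eventually_atTop.1 (h.tendsto_pow_mul.eventually (gt_mem_nhds hε))
  filter_upwards [eventually_ge_atTop (n + m)] with k hk w hw
  refine hball ?_
  obtain ⟨l, rfl⟩ := Nat.exists_eq_add_of_le hk
  rw [show n + m + l = (m + l) + n by ring, Function.iterate_add_apply]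
  exact (h.dist_iterate_le (hU w hw) _).trans_lt (hm _ (Nat.le_add_right _ _))

theorem basin_subset_fatouSet (hf : MeromorphicNFOn f univ) (h : IsContractedDisc f ξ r q) :
    basin f ξ ⊆ fatouSet f := by
  intro z hz
  obtain ⟨U, hU, hzU, hUb, n, hn⟩ := h.exists_open_iterate_mem hf hz
  refine ⟨U, hU, hzU, fun w hw => (hUb hw).1, fun u hu => ?_⟩
  choose k hk using hu
  by_cases hex : ∃ m, ∃ᶠ i in atTop, k i = m
  · obtain ⟨m, hm⟩ := hex
    obtain ⟨φ, hφ, hφm⟩ := extraction_of_frequently_atTop hm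
    refine ⟨φ, hφ, fun w => ((f^[m] w : ℂ) : OnePoint ℂ), ?_⟩
    have h1 : (fun i => u (φ i)) = fun _ w => ((f^[m] w : ℂ) : OnePoint ℂ) := by
      funext i
      rw [← hk, hφm]
    rw [h1]
    exact fun v hv w _ => ⟨univ, univ_mem, Eventually.of_forall fun _ _ _ => refl_mem_uniformity hv⟩
  · push Not at hex
    have htend : Tendsto k atTop atTop := tendsto_atTop.2 fun b => by
      have h1 : ∀ᶠ i in atTop, ∀ m ∈ Finset.range b, k i ≠ m :=
        (eventually_all_finset _).2 fun m _ => hex m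
      filter_upwards [h1] with i hi
      by_contra! hlt
      exact hi _ (Finset.mem_range.2 hlt) rfl
    refine ⟨id, strictMono_id, fun _ => (ξ : OnePoint ℂ),
      TendstoUniformlyOn.tendstoLocallyUniformlyOn ?_⟩
    intro v hv
    filter_upwards [htend.eventually (h.tendstoUniformlyOn_iterate hn v hv)] with i hi w hw
    rw [id, ← hk i]
    exact hi w hw

theorem fatouSet_subset_basin (hf : MeromorphicNFOn f univ) (h : IsContractedDisc f ξ r q)
    (htd : IsTotallyDisconnected ((↑) '' basin f ξ : Set (OnePoint ℂ))ᶜ) :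
    fatouSet f ⊆ basin f ξ := by
  rintro z ⟨U, hU, hzU, hdef, hnorm⟩
  obtain ⟨φ, hφ, g, hg⟩ := hnorm (fun k w => ((f^[k] w : ℂ) : OnePoint ℂ)) fun k => mem_range_self k
  have hcont : ∀ n, ContinuousOn (fun w => ((f^[n] w : ℂ) : OnePoint ℂ)) U := fun n => by
    refine OnePoint.continuous_coe.comp_continuousOn fun w hw => ContinuousAt.continuousWithinAt ?_
    induction n with
    | zero => exact continuousAt_id
    | succ n ih =>
      rw [Function.iterate_succ']
      exact (analyticAt_of_not_isPole hf (hdef w hw n)).continuousAt.comp ih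
  have hgc : ContinuousOn g U := hg.continuousOn (Eventually.of_forall fun n => hcont _).frequently
  have hpt : ∀ w ∈ U, Tendsto (fun n => ((f^[φ n] w : ℂ) : OnePoint ℂ)) atTop (𝓝 (g w)) :=
    fun w hw => hg.tendsto_at hw
  have hgb : ∀ w ∈ U, w ∈ basin f ξ → g w = ξ := fun w hw hwb =>
    tendsto_nhds_unique (hpt w hw) ((OnePoint.continuous_coe.tendsto ξ).comp
      (hwb.2.comp hφ.tendsto_atTop))
  have hgn : ∀ w ∈ U, g w = ξ → w ∈ basin f ξ := fun w hw hgw => by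
    have h1 : ((↑) '' Metric.ball ξ r : Set (OnePoint ℂ)) ∈ 𝓝 (g w) := by
      rw [hgw]
      exact OnePoint.isOpenMap_coe.image_mem_nhds (Metric.ball_mem_nhds ξ h.r_pos)
    obtain ⟨n, y, hy, hyn⟩ := ((hpt w hw).eventually h1).exists
    rw [OnePoint.coe_eq_coe] at hyn
    exact PostsingularSetup.mem_basin_of_iterate_mem (n := φ n) (fun k _ => hdef w hw k)
      (hyn ▸ h.closedBall_subset_basin (Metric.ball_subset_closedBall hy))
  obtain ⟨ε, hε, hball⟩ := Metric.isOpen_iff.1 hU z hzU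
  have hpre : IsPreconnected (Metric.ball z ε) := (convex_ball z ε).isPreconnected
  refine hpre.subset_of_closure_inter_subset (h.isOpen_basin hf) ?_ ?_ (Metric.mem_ball_self hε)
  · by_contra hne
    rw [not_nonempty_iff_eq_empty, ← disjoint_iff_inter_eq_empty] at hne
    have h1 : ((↑) '' Metric.ball z ε : Set (OnePoint ℂ)).Subsingleton := by
      refine htd _ ?_ (hpre.image _ OnePoint.continuous_coe.continuousOn)
      rintro _ ⟨y, hy, rfl⟩ ⟨w, hw, hwy⟩
      rw [OnePoint.coe_eq_coe] at hwy
      exact disjoint_left.1 hne hy (hwy ▸ hw)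
    have h2 : z + (ε / 2 : ℝ) ∈ Metric.ball z ε := by
      rw [Metric.mem_ball, dist_self_add_left, Complex.norm_real, Real.norm_of_nonneg] <;> linarith
    have h3 := h1 (mem_image_of_mem _ h2) (mem_image_of_mem _ (Metric.mem_ball_self hε))
    rw [OnePoint.coe_eq_coe, add_eq_left, Complex.ofReal_eq_zero] at h3
    linarith
  · rintro w ⟨hwc, hwB⟩
    refine hgn w (hball hwB) ?_
    have h1 : ContinuousAt g w := hgc.continuousAt (hU.mem_nhds (hball hwB))
    have h2 : ∃ᶠ y in 𝓝 w, g y ∈ ({(ξ : OnePoint ℂ)} : Set (OnePoint ℂ)) :=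
      ((mem_closure_iff_frequently.1 hwc).and_eventually (hU.mem_nhds (hball hwB))).mono
        fun y hy => hgb y hy.2 hy.1
    exact isClosed_singleton.mem_of_frequently_of_tendsto h2 h1

end IsContractedDisc

theorem continuous_inv_toSphere (ξ : ℂ) [DecidablePred fun t : ℂ => t = 0] : Continuous
    fun t : ℂ => if t = 0 then OnePoint.infty else ((ξ + t⁻¹ : ℂ) : OnePoint ℂ) := by
  rw [continuous_iff_continuousAt]
  intro t
  rcases eq_or_ne t 0 with rfl | ht
  · rw [ContinuousAt, if_pos rfl, ← nhdsNE_sup_pure, tendsto_sup]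
    refine ⟨?_, tendsto_pure_left.2 fun s hs => by simpa using! mem_of_mem_nhds hs⟩
    have h1 : Tendsto (fun t : ℂ => ξ + t⁻¹) (𝓝[≠] 0) (cocompact ℂ) := by
      rw [← Metric.cobounded_eq_cocompact]
      exact tendsto_const_add_cobounded ξ |>.comp tendsto_inv₀_nhdsNE_zero
    refine ((OnePoint.tendsto_coe_infty.mono_left
      (coclosedCompact_eq_cocompact (X := ℂ)).ge).comp h1).congr' ?_
    filter_upwards [self_mem_nhdsWithin] with s hs
    exact (if_neg hs).symm
  · have h1 : ContinuousAt (fun t : ℂ => ((ξ + t⁻¹ : ℂ) : OnePoint ℂ)) t :=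
      OnePoint.continuous_coe.continuousAt.comp (continuousAt_const.add (continuousAt_inv₀ ht))
    refine h1.congr ?_
    filter_upwards [isOpen_ne.mem_nhds ht] with s hs
    exact (if_neg hs).symm

open Classical in
/-- An open subset of the plane whose complement in the sphere is totally disconnected is
connected. -/
theorem isPreconnected_of_isTotallyDisconnected_compl {V : Set ℂ} (hV : IsOpen V) {ξ : ℂ}
    (hξ : ξ ∈ V) (htd : IsTotallyDisconnected ((↑) '' V : Set (OnePoint ℂ))ᶜ) :
    IsPreconnected V := by
  set K : Set ℂ := {t | t ≠ 0 ∧ ξ + t⁻¹ ∈ V}ᶜ with hKdef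
  have hKo : IsOpen Kᶜ := by
    rw [hKdef, compl_compl]
    have h1 : ContinuousOn (fun t : ℂ => ξ + t⁻¹) {t | t ≠ 0} :=
      continuousOn_const.add continuousOn_inv₀
    exact h1.isOpen_inter_preimage isOpen_ne hV
  obtain ⟨r, hr, hball⟩ := Metric.isOpen_iff.1 hV ξ hξ
  have hKc : IsCompact K := by
    refine (isCompact_closedBall (0 : ℂ) r⁻¹).of_isClosed_subset (isOpen_compl_iff.1 hKo) ?_
    intro t ht
    rw [mem_closedBall_zero_iff]
    by_contra! hlt
    have hrt : 0 < ‖t‖ := (inv_pos.2 hr).trans hlt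
    refine ht ⟨norm_pos_iff.1 hrt, hball ?_⟩
    rw [Metric.mem_ball, dist_self_add_left, norm_inv]
    exact inv_lt_of_inv_lt₀ hr hlt
  have hKtd : IsTotallyDisconnected K := by
    intro t htK ht
    have h1 := htd ((fun t : ℂ => if t = 0 then OnePoint.infty else
        ((ξ + t⁻¹ : ℂ) : OnePoint ℂ)) '' t)
      (by
        rintro _ ⟨s, hs, rfl⟩ ⟨v, hv, hvs⟩
        dsimp only at hvs
        split_ifs at hvs with h0
        · exact OnePoint.coe_ne_infty _ hvs
        · rw [OnePoint.coe_eq_coe] at hvs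
          exact htK hs ⟨h0, hvs ▸ hv⟩)
      (ht.image _ (continuous_inv_toSphere ξ).continuousOn)
    refine subsingleton_of_image (fun a b hab => ?_) _ h1
    split_ifs at hab with h2 h3 h3
    · rw [h2, h3]
    · exact absurd hab (OnePoint.infty_ne_coe _)
    · exact absurd hab (OnePoint.coe_ne_infty _)
    · rw [OnePoint.coe_eq_coe] at hab
      exact inv_injective (add_left_cancel hab)
  have hpre := isPreconnected_compl_of_isTotallyDisconnected hKc hKtd
  rw [hKdef, compl_compl] at hpre
  have himg : (fun t : ℂ => ξ + t⁻¹) '' {t | t ≠ 0 ∧ ξ + t⁻¹ ∈ V} = V ∩ {ξ}ᶜ := by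
    ext z
    constructor
    · rintro ⟨t, ⟨h1, h2⟩, rfl⟩
      exact ⟨h2, by simpa using h1⟩
    · rintro ⟨h1, h2⟩
      refine ⟨(z - ξ)⁻¹, ⟨inv_ne_zero (sub_ne_zero.2 h2), ?_⟩, ?_⟩
      · rwa [inv_inv, add_sub_cancel]
      · simp
  have h1 : IsPreconnected (V ∩ {ξ}ᶜ) := by
    rw [← himg]
    exact hpre.image _ (continuousOn_const.add (continuousOn_inv₀.mono fun t ht => ht.1))
  exact h1.subset_closure inter_subset_left ((dense_compl_singleton ξ).open_subset_closure_inter hV)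

end MeroDyn

theorem lemma6 (f : ℂ → ℂ) (hf : f ∈ MeroDyn.SpeiserClass)
    (hattr : ∃ ξ : ℂ, MeroDyn.IsAttractingFixedPoint f ξ ∧
      ∀ a : ℂ, (a : OnePoint ℂ) ∈ MeroDyn.singInv f → a ∈ MeroDyn.immediateBasin f ξ)
    (hasymp : ¬ MeroDyn.IsAsymptoticValue f OnePoint.infty)
    (hpoles : ∃ M : ℕ, ∀ z : ℂ, MeroDyn.IsPole f z →
      ((-(M : ℤ) : ℤ) : WithTop ℤ) ≤ meromorphicOrderAt f z) :
    IsTotallyDisconnected (MeroDyn.juliaSet f) ∧ IsConnected (MeroDyn.fatouSet f) := by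
  obtain ⟨ξ, hξ, hsing⟩ := hattr
  obtain ⟨M, hM⟩ := hpoles
  have hnf := hf.1.1
  obtain ⟨r, q, h⟩ := hξ.exists_isContractedDisc hnf
  obtain ⟨P, H, L, hS⟩ := h.exists_postsingularSetup hf hsing hasymp hM
  have htd := hS.isTotallyDisconnected_compl_basin
  have heq : MeroDyn.fatouSet f = MeroDyn.basin f ξ :=
    (h.fatouSet_subset_basin hnf htd).antisymm (h.basin_subset_fatouSet hnf)
  rw [MeroDyn.juliaSet, heq]
  exact ⟨htd, ⟨ξ, h.self_mem_basin⟩,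
    MeroDyn.isPreconnected_of_isTotallyDisconnected_compl (h.isOpen_basin hnf) h.self_mem_basin htd⟩
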